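/- Let $f=(f(0),f(1),\dots)$ be a complex time series such that for every $l\in\mathbb N$ the autocovariance $$\rho_l=\lim_{n\to\infty}\frac1n\sum_{k=0}^{n}f(k)\overline{f(k+l)}$$ exists. Let $\tilde{\mathcal H}_f$ be the complex linear span of the shifted series $F_l=(f(l),f(l+1),\dots)$, $l\ge 0$, with the (semi-)inner product $\langle h,g\rangle=\lim_{n\to\infty}\frac1n\sum_{k=0}^{n-1}h_k\overline{g_k}$, let $\mathcal H_f$ be its Hausdorff completion, a Hilbert space, and let $\mathcal K:\mathcal H_f\to\mathcal H_f$ be the isometry that extends $F_l\mapsto F_{l+1}$. Write $f$ also for the element of $\mathcal H_f$ given by $F_0$. Let $\mathcal H_U=\bigcap_{k\ge0}\mathcal K^k\mathcal H_f$ be the unitary part and $\mathcal H_{NU}=\mathcal H_U^\perp$ the completely non-unitary part of $\mathcal H_f$. For $g\in\mathcal H_U$ let $\nu_g$ be its spectral measure, the finite Borel measure on the unit circle $S^1$ with $\int z^k\,d\nu_g=\langle \mathcal K^kg,g\rangle$ for all $k\ge0$; let $\mathcal H_{sc}$ (respectively $\mathcal H_{ac}$) be the set of $g\in\mathcal H_U$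 for which $\nu_g$ is without atoms and singular to Lebesgue measure (respectively absolutely continuous with respect to Lebesgue measure). Then $f$ has a decomposition $$f=\sum_{i}a_iv_i+f_{sc}+f_{ac}+f_{NU},\qquad f_{sc}\in\mathcal H_{sc},\ f_{ac}\in\mathcal H_{ac},\ f_{NU}\in\mathcal H_{NU},$$ where $v_1,v_2,\dots$ is a finite or infinite orthonormal list of eigenvectors of $\mathcal K$ that contains every eigenvector of $\mathcal K$ up to a scalar, and $|a_1|\ge|a_2|\ge\cdots\ge0$ (put $a_i=0$ when $i$ exceeds the number of eigenvectors). Moreover, let $G_{NM}(f)$ be the Gram matrix with entries $$G_{NM,ij}(f)=\frac1M\sum_{t=0}^{M}f(i+t)\overline{f(j+t)},\qquad 0\le i,j\le N,$$ and $d_{NM,1}\ge d_{NM,2}\ge\dots\ge d_{NM,N+1}\ge0$ its eigenvalues with multiplicity. Then for every such decomposition and every $i\ge1$ the iterated limit below exists and $$\lim_{N\to\infty}\lim_{M\to\infty}\frac{d_{NM,i}}{N}=|a_i|^2 .$$ -/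

import Mathlib

open Filter Topology MeasureTheory

noncomputable section

namespace TimeShift

/-! ### Time series with autocovariances -/

/-- The autocovariances `ρ_l = lim_n (1/n) ∑_{k=0}^n f(k) conj f(k+l)` exist for all `l`. -/
def HasAutocovariances (f : ℕ → ℂ) : Prop :=
  ∀ l : ℕ, ∃ ρ : ℂ, Tendsto
    (fun n : ℕ => (1 / (n : ℂ)) * ∑ k ∈ Finset.range (n + 1), f k * starRingEnd ℂ (f (k + l)))
    atTop (𝓝 ρ)

/-- The time average `(1/n) ∑_{k=0}^{n-1} h_k conj g_k`. -/
def timeAverage (h g : ℕ → ℂ) (n : ℕ) : ℂ :=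
  (1 / (n : ℂ)) * ∑ k ∈ Finset.range n, h k * starRingEnd ℂ (g k)

/-- The linear span of the shifted series `F_l = (f(l), f(l+1), …)`. -/
def shiftSpan (f : ℕ → ℂ) : Submodule ℂ (ℕ → ℂ) :=
  Submodule.span ℂ (Set.range fun l : ℕ => fun k : ℕ => f (k + l))

theorem HasAutocovariances.sum_tendsto {f : ℕ → ℂ} (hf : HasAutocovariances f) (l : ℕ) :
    ∃ ρ : ℂ, Tendsto (fun n : ℕ => (1 / (n : ℂ)) *
      ∑ k ∈ Finset.range n, f k * starRingEnd ℂ (f (k + l))) atTop (𝓝 ρ) := by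
  obtain ⟨ρ, hρ⟩ := hf l
  refine ⟨ρ, (tendsto_add_atTop_iff_nat 1).1 ?_⟩
  have h1 : Tendsto (fun n : ℕ => (n : ℂ) / ((n : ℂ) + 1)) atTop (𝓝 1) :=
    tendsto_natCast_div_add_atTop (1 : ℂ)
  have h2 := h1.mul hρ
  rw [one_mul] at h2
  refine h2.congr' ?_
  filter_upwards [eventually_gt_atTop 0] with n hn
  have hn' : (n : ℂ) ≠ 0 := by exact_mod_cast hn.ne'
  have hn1 : (n : ℂ) + 1 ≠ 0 := by exact_mod_cast n.succ_ne_zero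
  push_cast
  field_simp

theorem HasAutocovariances.shift_tendsto {f : ℕ → ℂ} (hf : HasAutocovariances f) (c l : ℕ) :
    ∃ ρ : ℂ, Tendsto
      (timeAverage (fun k => f (k + c)) (fun k => f (k + (c + l)))) atTop (𝓝 ρ) := by
  obtain ⟨ρ, hρ⟩ := hf.sum_tendsto l
  refine ⟨ρ, ?_⟩
  set u : ℕ → ℂ := fun k => f k * starRingEnd ℂ (f (k + l)) with hu
  have hS : ∀ n : ℕ, timeAverage (fun k => f (k + c)) (fun k => f (k + (c + l))) n =
      (((n + c : ℕ) : ℂ) / n) * ((1 / ((n + c : ℕ) : ℂ)) * ∑ k ∈ Finset.range (n + c), u k) -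
        (1 / (n : ℂ)) * ∑ k ∈ Finset.range c, u k := by
    intro n
    rcases Nat.eq_zero_or_pos n with rfl | hn
    · simp [timeAverage]
    have hn' : (n : ℂ) ≠ 0 := by exact_mod_cast hn.ne'
    have hn1 : ((n + c : ℕ) : ℂ) ≠ 0 := by
      have : n + c ≠ 0 := by omega
      exact_mod_cast this
    have hsum : ∑ k ∈ Finset.range (n + c), u k =
        ∑ k ∈ Finset.range c, u k + ∑ k ∈ Finset.range n, u (k + c) := by
      rw [add_comm n c, Finset.sum_range_add]
      simp [add_comm]
    have hterm : ∑ k ∈ Finset.range n, f (k + c) * starRingEnd ℂ (f (k + (c + l))) =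
        ∑ k ∈ Finset.range n, u (k + c) := by
      simp [hu, add_assoc]
    rw [timeAverage, hterm, hsum]
    field_simp
    ring
  have h1 : Tendsto (fun n : ℕ => (1 : ℂ) / (n : ℂ)) atTop (𝓝 0) :=
    tendsto_one_div_atTop_nhds_zero_nat
  have h2 : Tendsto (fun n : ℕ => ((n + c : ℕ) : ℂ) / (n : ℂ)) atTop (𝓝 1) := by
    have h3 : Tendsto (fun n : ℕ => 1 + (c : ℂ) * (1 / (n : ℂ))) atTop (𝓝 (1 + (c : ℂ) * 0)) :=
      tendsto_const_nhds.add (tendsto_const_nhds.mul h1)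
    rw [mul_zero, add_zero] at h3
    refine h3.congr' ?_
    filter_upwards [eventually_gt_atTop 0] with n hn
    have hn' : (n : ℂ) ≠ 0 := by exact_mod_cast hn.ne'
    push_cast
    field_simp
  have h4 := (h2.mul ((tendsto_add_atTop_iff_nat c).2 hρ)).sub
    (h1.mul_const (∑ k ∈ Finset.range c, u k))
  simp only [one_mul, zero_mul, sub_zero] at h4
  exact h4.congr fun n => (hS n).symm

theorem timeAverage_swap (h g : ℕ → ℂ) (n : ℕ) :
    starRingEnd ℂ (timeAverage h g n) = timeAverage g h n := by
  simp [timeAverage, mul_comm]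

theorem timeAverage_add_left (h h' g : ℕ → ℂ) (n : ℕ) :
    timeAverage (h + h') g n = timeAverage h g n + timeAverage h' g n := by
  simp [timeAverage, add_mul, Finset.sum_add_distrib, mul_add]

theorem timeAverage_smul_left (c : ℂ) (h g : ℕ → ℂ) (n : ℕ) :
    timeAverage (c • h) g n = c * timeAverage h g n := by
  simp only [timeAverage, Pi.smul_apply, smul_eq_mul, mul_assoc, ← Finset.mul_sum]
  ring

theorem timeAverage_add_right (h g g' : ℕ → ℂ) (n : ℕ) :
    timeAverage h (g + g') n = timeAverage h g n + timeAverage h g' n := by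
  simp [timeAverage, mul_add, Finset.sum_add_distrib]

theorem timeAverage_smul_right (c : ℂ) (h g : ℕ → ℂ) (n : ℕ) :
    timeAverage h (c • g) n = starRingEnd ℂ c * timeAverage h g n := by
  rw [← timeAverage_swap, timeAverage_smul_left, map_mul, timeAverage_swap]

/-- Time averages of products converge on the span of the shifts. -/
theorem HasAutocovariances.exists_limit {f : ℕ → ℂ} (hf : HasAutocovariances f)
    {h g : ℕ → ℂ} (hh : h ∈ shiftSpan f) (hg : g ∈ shiftSpan f) :
    ∃ ρ : ℂ, Tendsto (timeAverage h g) atTop (𝓝 ρ) := by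
  have zero_left : ∀ g, timeAverage 0 g = fun _ => 0 := by
    intro g; ext n; simp [timeAverage]
  have zero_right : ∀ g, timeAverage g 0 = fun _ => 0 := by
    intro g; ext n; simp [timeAverage]
  induction hh using Submodule.span_induction with
  | mem x hx =>
    obtain ⟨a, rfl⟩ := hx
    induction hg using Submodule.span_induction with
    | mem y hy =>
      obtain ⟨b, rfl⟩ := hy
      rcases le_total a b with hab | hab
      · obtain ⟨l, rfl⟩ := Nat.exists_eq_add_of_le hab
        exact hf.shift_tendsto a l
      · obtain ⟨l, rfl⟩ := Nat.exists_eq_add_of_le hab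
        obtain ⟨ρ, hρ⟩ := hf.shift_tendsto b l
        refine ⟨starRingEnd ℂ ρ, ?_⟩
        have := (Complex.continuous_conj.tendsto ρ).comp hρ
        exact this.congr fun n => timeAverage_swap _ _ n
    | zero => exact ⟨0, by rw [zero_right]; exact tendsto_const_nhds⟩
    | add y z _ _ ihy ihz =>
      obtain ⟨ρ, hρ⟩ := ihy
      obtain ⟨τ, hτ⟩ := ihz
      exact ⟨ρ + τ, (hρ.add hτ).congr fun n => (timeAverage_add_right _ _ _ n).symm⟩
    | smul c y _ ih =>
      obtain ⟨ρ, hρ⟩ := ih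
      exact ⟨starRingEnd ℂ c * ρ,
        (hρ.const_mul _).congr fun n => (timeAverage_smul_right _ _ _ n).symm⟩
  | zero => exact ⟨0, by rw [zero_left]; exact tendsto_const_nhds⟩
  | add y z _ _ ihy ihz =>
    obtain ⟨ρ, hρ⟩ := ihy
    obtain ⟨τ, hτ⟩ := ihz
    exact ⟨ρ + τ, (hρ.add hτ).congr fun n => (timeAverage_add_left _ _ _ n).symm⟩
  | smul c y _ ih =>
    obtain ⟨ρ, hρ⟩ := ih
    exact ⟨c * ρ, (hρ.const_mul _).congr fun n => (timeAverage_smul_left _ _ _ n).symm⟩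

/-! ### The Hilbert space of the series -/

/-- The span of the shifts of `f`, as a type that will carry the semi-inner product given by
time averages. -/
def PreSpace (f : ℕ → ℂ) (_hf : HasAutocovariances f) : Type := shiftSpan f

variable {f : ℕ → ℂ} {hf : HasAutocovariances f}

instance : AddCommGroup (PreSpace f hf) := inferInstanceAs (AddCommGroup (shiftSpan f))

instance : Module ℂ (PreSpace f hf) := inferInstanceAs (Module ℂ (shiftSpan f))

/-- The underlying sequence of an element of the span. -/
def PreSpace.seq (x : PreSpace f hf) : ℕ → ℂ := Subtype.val (p := (· ∈ shiftSpan f)) x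

/-- `⟨h, g⟩ = lim_n (1/n) ∑_{k<n} h_k conj g_k`, linear in `h`. -/
def avgInner (h g : PreSpace f hf) : ℂ := limUnder atTop (timeAverage h.seq g.seq)

theorem avgInner_spec (h g : PreSpace f hf) :
    Tendsto (timeAverage h.seq g.seq) atTop (𝓝 (avgInner h g)) :=
  tendsto_nhds_limUnder (hf.exists_limit h.2 g.2)

/-- In Mathlib's convention the inner product is linear in the second argument, so
`inner x y` is the time average of `y_k conj x_k`. -/
@[reducible]
def preCore : PreInnerProductSpace.Core ℂ (PreSpace f hf) where
  inner x y := avgInner y x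
  conj_inner_symm x y := by
    have h1 := (Complex.continuous_conj.tendsto _).comp (avgInner_spec x y)
    exact tendsto_nhds_unique (h1.congr fun n => timeAverage_swap _ _ n) (avgInner_spec y x)
  re_inner_nonneg x := by
    have h1 := (Complex.continuous_re.tendsto _).comp (avgInner_spec x x)
    refine ge_of_tendsto' h1 fun n => ?_
    have h2 : timeAverage x.seq x.seq n =
        (((1 / (n : ℝ)) * ∑ k ∈ Finset.range n, Complex.normSq (x.seq k) : ℝ) : ℂ) := by
      simp [timeAverage, Complex.mul_conj]
    simp only [Function.comp_apply, h2, Complex.ofReal_re]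
    exact mul_nonneg (by positivity) (Finset.sum_nonneg fun k _ => Complex.normSq_nonneg _)
  add_left x y z := by
    exact tendsto_nhds_unique (avgInner_spec z (x + y))
      (((avgInner_spec z x).add (avgInner_spec z y)).congr fun n =>
        (timeAverage_add_right z.seq x.seq y.seq n).symm)
  smul_left x y r := by
    exact tendsto_nhds_unique (avgInner_spec y (r • x))
      (((avgInner_spec y x).const_mul _).congr fun n =>
        (timeAverage_smul_right r y.seq x.seq n).symm)

instance : SeminormedAddCommGroup (PreSpace f hf) :=
  InnerProductSpace.Core.toSeminormedAddCommGroup (𝕜 := ℂ) (c := preCore)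

instance : InnerProductSpace ℂ (PreSpace f hf) := InnerProductSpace.ofCore preCore

/-- The Hilbert space `H_f`: the (Hausdorff) completion of the span of the shifts of `f`. -/
abbrev HSpace (f : ℕ → ℂ) (hf : HasAutocovariances f) : Type :=
  UniformSpace.Completion (PreSpace f hf)

/-- The series `f` as an element of the span of its shifts. -/
def preObs (f : ℕ → ℂ) (hf : HasAutocovariances f) : PreSpace f hf :=
  ⟨f, Submodule.subset_span ⟨0, rfl⟩⟩

/-- The series `f` as an element of `H_f`. -/
def obs (f : ℕ → ℂ) (hf : HasAutocovariances f) : HSpace f hf := (preObs f hf : HSpace f hf)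

/-! ### The time-shift operator -/

/-- The shift `(h_0, h_1, …) ↦ (h_1, h_2, …)` of sequences; it sends `F_l` to `F_{l+1}`. -/
def seqShift : (ℕ → ℂ) →ₗ[ℂ] (ℕ → ℂ) where
  toFun h k := h (k + 1)
  map_add' _ _ := rfl
  map_smul' _ _ := rfl

theorem seqShift_mem {h : ℕ → ℂ} (hh : h ∈ shiftSpan f) : seqShift h ∈ shiftSpan f := by
  induction hh using Submodule.span_induction with
  | mem x hx =>
    obtain ⟨l, rfl⟩ := hx
    refine Submodule.subset_span ⟨l + 1, ?_⟩
    ext k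
    show f (k + (l + 1)) = f (k + 1 + l)
    congr 1
    omega
  | zero => simp
  | add y z _ _ ihy ihz => rw [map_add]; exact add_mem ihy ihz
  | smul c y _ ih => rw [map_smul]; exact Submodule.smul_mem _ _ ih

/-- The shift on the span of the shifts of `f`. -/
def preShiftₗ (f : ℕ → ℂ) (hf : HasAutocovariances f) : PreSpace f hf →ₗ[ℂ] PreSpace f hf :=
  (seqShift.restrict fun _ hh => seqShift_mem hh : shiftSpan f →ₗ[ℂ] shiftSpan f)

theorem norm_sq_eq_re_avgInner (x : PreSpace f hf) : ‖x‖ ^ 2 = (avgInner x x).re :=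
  InnerProductSpace.norm_sq_eq_re_inner (𝕜 := ℂ) x

theorem norm_preShiftₗ (x : PreSpace f hf) : ‖preShiftₗ f hf x‖ = ‖x‖ := by
  have key : avgInner (preShiftₗ f hf x) (preShiftₗ f hf x) = avgInner x x := by
    refine tendsto_nhds_unique (avgInner_spec _ _) ?_
    have h1 : Tendsto (fun n : ℕ => (1 : ℂ) / (n : ℂ)) atTop (𝓝 0) :=
      tendsto_one_div_atTop_nhds_zero_nat
    have h2 : Tendsto (fun n : ℕ => 1 + (1 : ℂ) / (n : ℂ)) atTop (𝓝 1) := by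
      simpa using h1.const_add (1 : ℂ)
    have h3 := (h2.mul ((tendsto_add_atTop_iff_nat 1).2 (avgInner_spec x x))).sub
      (h1.mul_const (x.seq 0 * starRingEnd ℂ (x.seq 0)))
    simp only [one_mul, zero_mul, sub_zero] at h3
    refine h3.congr' ?_
    filter_upwards [eventually_gt_atTop 0] with n hn
    have hn' : (n : ℂ) ≠ 0 := by exact_mod_cast hn.ne'
    have hn1 : (n : ℂ) + 1 ≠ 0 := by exact_mod_cast n.succ_ne_zero
    have hseq : (preShiftₗ f hf x).seq = fun k => x.seq (k + 1) := rfl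
    rw [hseq, timeAverage, timeAverage, Finset.sum_range_succ']
    push_cast
    field_simp
    ring
  have h := norm_sq_eq_re_avgInner (preShiftₗ f hf x)
  rw [key, ← norm_sq_eq_re_avgInner] at h
  exact (sq_eq_sq₀ (norm_nonneg _) (norm_nonneg _)).1 h

/-- The shift on the span of the shifts of `f`, as an isometry for the time-average seminorm. -/
def preShift (f : ℕ → ℂ) (hf : HasAutocovariances f) : PreSpace f hf →ₗᵢ[ℂ] PreSpace f hf :=
  ⟨preShiftₗ f hf, norm_preShiftₗ⟩

/-- The time-shift operator `K` on `H_f`: the continuous extension of the shift. -/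
def timeShift (f : ℕ → ℂ) (hf : HasAutocovariances f) : HSpace f hf →ₗᵢ[ℂ] HSpace f hf where
  toLinearMap := ((preShift f hf).toContinuousLinearMap.completion : HSpace f hf →ₗ[ℂ] HSpace f hf)
  norm_map' x := by
    induction x using UniformSpace.Completion.induction_on with
    | hp =>
      exact isClosed_eq
        ((preShift f hf).toContinuousLinearMap.completion.continuous.norm) continuous_norm
    | ih x => simp

/-! ### Spectral parts of an isometry -/

/-- The Borel σ-algebra of the unit circle. -/
instance : MeasurableSpace Circle := borel Circle

instance : BorelSpace Circle := ⟨rfl⟩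

section Isometry

variable {E : Type*} [NormedAddCommGroup E] [InnerProductSpace ℂ E]

/-- The unitary part `⋂_k V^k E` of an isometry `V` (Wold decomposition): the largest closed
subspace that `V` maps onto itself. -/
def unitaryPart (V : E →ₗᵢ[ℂ] E) : Submodule ℂ E :=
  ⨅ k : ℕ, LinearMap.range (V ^ k).toLinearMap

/-- The completely non-unitary part: the orthogonal complement of the unitary part. -/
def nonUnitaryPart (V : E →ₗᵢ[ℂ] E) : Submodule ℂ E := (unitaryPart V)ᗮ

/-- `ν` is the spectral measure of the vector `g`: a finite Borel measure on the unit circle with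
`∫ z^k dν = ⟨V^k g, g⟩` for `k ≥ 0` (with Mathlib's `inner`, linear in the second argument). -/
def IsSpectralMeasure (V : E →ₗᵢ[ℂ] E) (g : E) (ν : Measure Circle) : Prop :=
  IsFiniteMeasure ν ∧ ∀ k : ℕ, ∫ z : Circle, (z : ℂ) ^ k ∂ν = inner ℂ g ((V ^ k) g)

/-- Arc length (Lebesgue measure) on the unit circle. -/
def arcLength : Measure Circle :=
  Measure.map Circle.exp (volume.restrict (Set.Ioc (-Real.pi) Real.pi))

/-- The singular continuous subspace: vectors of the unitary part whose spectral measure has no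
atoms and is singular to Lebesgue measure. -/
def singularContinuousPart (V : E →ₗᵢ[ℂ] E) : Set E :=
  {g | g ∈ unitaryPart V ∧
    ∃ ν : Measure Circle, IsSpectralMeasure V g ν ∧ (∀ z : Circle, ν {z} = 0) ∧ ν ⟂ₘ arcLength}

/-- The absolutely continuous subspace: vectors of the unitary part whose spectral measure is
absolutely continuous with respect to Lebesgue measure. -/
def absolutelyContinuousPart (V : E →ₗᵢ[ℂ] E) : Set E :=
  {g | g ∈ unitaryPart V ∧ ∃ ν : Measure Circle, IsSpectralMeasure V g ν ∧ ν ≪ arcLength}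

/-- A decomposition `g = ∑ a_i v_i + g_sc + g_ac + g_NU` with respect to an isometry `V`. The
eigenvectors are `v_i` for `i < n`, where `n` is finite or infinite; the coefficients `a_i` with
`i ≥ n` are zero, and the corresponding `v_i` are meaningless. Indices start at `0`. -/
structure SpectralDecomposition (V : E →ₗᵢ[ℂ] E) (g : E) where
  /-- The number of eigenvectors. -/
  n : ℕ∞
  /-- The eigenvectors of unit length. -/
  v : ℕ → E
  /-- The coefficients. -/
  a : ℕ → ℂ
  /-- The singular continuous component. -/
  gsc : E
  /-- The absolutely continuous component. -/
  gac : E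
  /-- The completely non-unitary component. -/
  gnu : E
  orthonormal : Orthonormal ℂ fun i : {i : ℕ // (i : ℕ∞) < n} => v i
  eigenvector : ∀ i : ℕ, (i : ℕ∞) < n → ∃ ξ : ℂ, V (v i) = ξ • v i
  /-- Every eigenvector occurs in the list, up to a scalar. -/
  complete : ∀ w : E, w ≠ 0 → (∃ ξ : ℂ, V w = ξ • w) → ∃ i : ℕ, (i : ℕ∞) < n ∧ ∃ c : ℂ, w = c • v i
  coeff_eq_zero : ∀ i : ℕ, n ≤ (i : ℕ∞) → a i = 0
  coeff_antitone : Antitone fun i => ‖a i‖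
  gsc_mem : gsc ∈ singularContinuousPart V
  gac_mem : gac ∈ absolutelyContinuousPart V
  gnu_mem : gnu ∈ nonUnitaryPart V
  /-- The sum of the `a_i v_i` converges, and the components add up to `g`. -/
  hasSum : HasSum (fun i => a i • v i) (g - gsc - gac - gnu)

end Isometry

/-! ### Gram matrices -/

/-- The Gram matrix with entries `(1/M) ∑_{t=0}^M f(i+t) conj f(j+t)`, `0 ≤ i, j ≤ N`. -/
def gramMatrix (f : ℕ → ℂ) (N M : ℕ) : Matrix (Fin (N + 1)) (Fin (N + 1)) ℂ :=
  Matrix.of fun i j =>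
    (1 / (M : ℂ)) * ∑ t ∈ Finset.range (M + 1), f (i + t) * starRingEnd ℂ (f (j + t))

theorem gramMatrix_isHermitian (f : ℕ → ℂ) (N M : ℕ) : (gramMatrix f N M).IsHermitian := by
  ext i j
  simp [gramMatrix, Matrix.conjTranspose_apply, mul_comm]

/-- The eigenvalues of the Gram matrix in nonincreasing order with multiplicity, indexed from `0`;
the value is `0` for `i > N`. -/
def gramEigenvalue (f : ℕ → ℂ) (N M i : ℕ) : ℝ :=
  if h : i < N + 1 then
    (gramMatrix_isHermitian f N M).eigenvalues₀ ⟨i, by simpa using h⟩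
  else 0

end TimeShift

end

noncomputable section

namespace TimeShift

/-! ### Min-max bounds for the sorted eigenvalues of a symmetric operator -/

section MinMax

/-! Limits of eigenvalues. For fixed `N` the matrices `gramMatrix f N M` converge entrywise to
`orbitGram`, the Gram matrix of `f, K f, …, K^N f` in `H_f`, and sorted eigenvalues of Hermitian
matrices are continuous (Weyl). The quadratic form of `orbitGram` at `c` is `‖∑ conj c_l K^l f‖ ^
2`. An eigenvector `v_j` with eigenvalue `ξ_j` enters this sum only through the inner product of `c`
with `e_j = (1, ξ_j, …, ξ_j^N)`. The `e_j` have squared norm `N + 1`, while distinct ones have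
bounded inner products (geometric sums), so they are nearly orthogonal and the point spectrum
contributes eigenvalues close to `(N + 1) |a_j|^2`.

The rest of `f` contributes `o(N)`: its autocorrelations tend to zero in quadratic mean, by Wiener's
lemma for an atomless spectral measure and by plain decay on the completely non-unitary part, and
Schur's test turns this into an operator bound (`IsNegligible`). Min-max then concludes. From below,
the form is tested on the span of `e_0, …, e_i`, with Bessel's inequality in the `v_j`
(`exists_le_orbitGramEigenvalue`). From above, it is tested on the vectors orthogonal to `e_0, …,
e_{i-1}`, with the small tail of the series absorbed in `ε` (`exists_orbitGramEigenvalue_le`).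

Existence of the decomposition. `K` is unitary on its unitary part. Functional calculus and the
Riesz representation theorem model a cyclic subspace there as `L²(ν)` on the circle, where cutting
the circle into the atoms of `ν`, a Lebesgue-null set and the remainder splits the vector. Since `f`
is cyclic, every eigenvalue is simple and no eigenvector is orthogonal to `f`; so the nonzero,
square-summable coefficients can be sorted (`nonempty_spectralDecomposition`). -/

theorem norm_sq_eq_sum_repr {E : Type*} [NormedAddCommGroup E] [InnerProductSpace ℂ E] {n : ℕ}
    (b : OrthonormalBasis (Fin n) ℂ E) (x : E) :
    ‖x‖ ^ 2 = ∑ j, ‖b.repr x j‖ ^ 2 := by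
  rw [← b.repr.norm_map x, EuclideanSpace.norm_sq_eq]

variable {E : Type*} [NormedAddCommGroup E] [InnerProductSpace ℂ E] [FiniteDimensional ℂ E]
  {n : ℕ} {T T' : E →ₗ[ℂ] E}

theorem re_inner_apply_self_eq_sum (hT : T.IsSymmetric) (hn : Module.finrank ℂ E = n) (x : E) :
    (inner ℂ (T x) x).re =
      ∑ j, hT.eigenvalues hn j * ‖(hT.eigenvectorBasis hn).repr x j‖ ^ 2 := by
  rw [← (hT.eigenvectorBasis hn).repr.inner_map_map, PiLp.inner_apply, Complex.re_sum]
  refine Finset.sum_congr rfl fun j _ => ?_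
  rw [hT.eigenvectorBasis_apply_self_apply hn x j]
  simp only [RCLike.inner_apply, map_mul, Complex.coe_algebraMap, Complex.conj_ofReal]
  rw [mul_left_comm, Complex.mul_conj, Complex.normSq_eq_norm_sq, ← Complex.ofReal_mul,
    Complex.ofReal_re]

/-- A lower bound of the quadratic form on a space of dimension more than `i` is a lower bound
of the `i`-th eigenvalue. -/
theorem le_eigenvalues_of_injective (hT : T.IsSymmetric) (hn : Module.finrank ℂ E = n)
    (i : Fin n) {F : Type*} [AddCommGroup F] [Module ℂ F] [FiniteDimensional ℂ F]
    (ψ : F →ₗ[ℂ] E) (hψ : Function.Injective ψ) (hF : (i : ℕ) < Module.finrank ℂ F) {c : ℝ}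
    (h : ∀ s, c * ‖ψ s‖ ^ 2 ≤ (inner ℂ (T (ψ s)) (ψ s)).re) :
    c ≤ hT.eigenvalues hn i := by
  set b := hT.eigenvectorBasis hn with hb
  -- The first `i` coordinates in the eigenbasis. They vanish at some nonzero vector for dimension
  -- reasons, and there the form is at most the `i`-th eigenvalue times the squared norm.
  let φ : F →ₗ[ℂ] (Fin i → ℂ) :=
    LinearMap.pi fun j => (LinearMap.proj (Fin.castLE i.2.le j)).comp
      ((WithLp.linearEquiv 2 ℂ (Fin n → ℂ)).toLinearMap.comp
        (b.repr.toLinearEquiv.toLinearMap.comp ψ))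
  have hker : LinearMap.ker φ ≠ ⊥ := φ.ker_ne_bot_of_finrank_lt (by simpa using hF)
  obtain ⟨s, hs, hs0⟩ := Submodule.exists_mem_ne_zero_of_ne_bot hker
  have hx0 : ψ s ≠ 0 := fun h0 => hs0 (hψ (by simpa using h0))
  have hrep : ∀ j : Fin n, j < i → b.repr (ψ s) j = 0 := fun j hj =>
    congrFun (LinearMap.mem_ker.1 hs) (⟨j, hj⟩ : Fin i)
  have h1 := h s
  rw [re_inner_apply_self_eq_sum hT hn] at h1
  have h2 : ∑ j, hT.eigenvalues hn j * ‖b.repr (ψ s) j‖ ^ 2 ≤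
      hT.eigenvalues hn i * ‖ψ s‖ ^ 2 := by
    rw [norm_sq_eq_sum_repr b, Finset.mul_sum]
    refine Finset.sum_le_sum fun j _ => ?_
    rcases lt_or_ge j i with hj | hj
    · simp [hrep j hj]
    · exact mul_le_mul_of_nonneg_right (hT.eigenvalues_antitone hn hj) (by positivity)
  exact le_of_mul_le_mul_right (h1.trans h2) (by positivity)

/-- An upper bound of the quadratic form on the solution space of `i` linear equations is an
upper bound of the `i`-th eigenvalue. -/
theorem eigenvalues_le_of_ker (hT : T.IsSymmetric) (hn : Module.finrank ℂ E = n)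
    (i : Fin n) (φ : E →ₗ[ℂ] (Fin i → ℂ)) {c : ℝ}
    (h : ∀ x, φ x = 0 → (inner ℂ (T x) x).re ≤ c * ‖x‖ ^ 2) :
    hT.eigenvalues hn i ≤ c := by
  set b := hT.eigenvectorBasis hn with hb
  -- The eigencoordinates after `i`. Together with `φ` these are `i + (n - 1 - i) < n` equations, so
  -- a common nonzero solution exists.
  let χ : E →ₗ[ℂ] ({j : Fin n // i < j} → ℂ) :=
    LinearMap.pi fun j => (LinearMap.proj j.1).comp
      ((WithLp.linearEquiv 2 ℂ (Fin n → ℂ)).toLinearMap.comp b.repr.toLinearEquiv.toLinearMap)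
  have hcard : Fintype.card {j : Fin n // i < j} = n - 1 - i := by
    rw [Fintype.card_subtype]
    have : (Finset.univ.filter fun j : Fin n => i < j) = Finset.Ioi i := by ext; simp
    rw [this, Fin.card_Ioi]
  have hker : LinearMap.ker (φ.prod χ) ≠ ⊥ := (φ.prod χ).ker_ne_bot_of_finrank_lt (by
    rw [Module.finrank_prod, Module.finrank_fin_fun, Module.finrank_fintype_fun_eq_card, hcard, hn]
    have := i.2
    omega)
  obtain ⟨x, hx, hx0⟩ := Submodule.exists_mem_ne_zero_of_ne_bot hker
  have hx' : φ x = 0 ∧ χ x = 0 := by simpa [Prod.ext_iff] using hx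
  have hrep : ∀ j : Fin n, i < j → b.repr x j = 0 := fun j hj =>
    congrFun hx'.2 (⟨j, hj⟩ : {j : Fin n // i < j})
  have h1 := h x hx'.1
  rw [re_inner_apply_self_eq_sum hT hn] at h1
  have h2 : hT.eigenvalues hn i * ‖x‖ ^ 2 ≤ ∑ j, hT.eigenvalues hn j * ‖b.repr x j‖ ^ 2 := by
    rw [norm_sq_eq_sum_repr b, Finset.mul_sum]
    refine Finset.sum_le_sum fun j _ => ?_
    rcases lt_or_ge i j with hj | hj
    · simp [hrep j hj]
    · exact mul_le_mul_of_nonneg_right (hT.eigenvalues_antitone hn hj) (by positivity)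
  exact le_of_mul_le_mul_right (h2.trans h1) (by positivity)

/-- One half of Weyl's perturbation inequality. -/
theorem eigenvalues_le_add_of_forall_le (hT : T.IsSymmetric) (hT' : T'.IsSymmetric)
    (hn : Module.finrank ℂ E = n) (i : Fin n) {ε : ℝ}
    (h : ∀ x, (inner ℂ (T x) x).re ≤ (inner ℂ (T' x) x).re + ε * ‖x‖ ^ 2) :
    hT.eigenvalues hn i ≤ hT'.eigenvalues hn i + ε := by
  set b := hT'.eigenvectorBasis hn with hb
  -- The test space for `T` is the one that is optimal for `T'`: the first `i` eigencoordinates of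
  -- `T'` vanish.
  let φ : E →ₗ[ℂ] (Fin i → ℂ) :=
    LinearMap.pi fun j => (LinearMap.proj (Fin.castLE i.2.le j)).comp
      ((WithLp.linearEquiv 2 ℂ (Fin n → ℂ)).toLinearMap.comp b.repr.toLinearEquiv.toLinearMap)
  refine eigenvalues_le_of_ker hT hn i φ fun x hx => (h x).trans ?_
  have hrep : ∀ j : Fin n, j < i → b.repr x j = 0 := fun j hj =>
    congrFun hx (⟨j, hj⟩ : Fin i)
  rw [add_mul, re_inner_apply_self_eq_sum hT' hn]
  gcongr
  rw [norm_sq_eq_sum_repr b, Finset.mul_sum]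
  refine Finset.sum_le_sum fun j _ => ?_
  rcases lt_or_ge j i with hj | hj
  · simp [← hb, hrep j hj]
  · exact mul_le_mul_of_nonneg_right (hT'.eigenvalues_antitone hn hj) (by positivity)

end MinMax

/-! ### Continuity of sorted eigenvalues of Hermitian matrices. -/

theorem re_inner_toEuclideanLin_eq {ι : Type*} [Fintype ι] [DecidableEq ι] (A : Matrix ι ι ℂ)
    (x : EuclideanSpace ℂ ι) :
    (inner ℂ (Matrix.toEuclideanLin A x) x).re =
      (∑ i, ∑ j, A i j * x j * starRingEnd ℂ (x i)).re := by
  rw [← Complex.conj_re, inner_conj_symm, PiLp.inner_apply]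
  simp [Matrix.toLpLin_apply, Matrix.mulVec, dotProduct, Finset.sum_mul]

/-- The sorted eigenvalues of Hermitian matrices are continuous. -/
theorem tendsto_eigenvalues₀ {ι : Type*} [Fintype ι] [DecidableEq ι] {A : ℕ → Matrix ι ι ℂ}
    {B : Matrix ι ι ℂ} (hA : ∀ M, (A M).IsHermitian) (hB : B.IsHermitian)
    (h : ∀ i j, Tendsto (fun M => A M i j) atTop (𝓝 (B i j))) (i : Fin (Fintype.card ι)) :
    Tendsto (fun M => (hA M).eigenvalues₀ i) atTop (𝓝 (hB.eigenvalues₀ i)) := by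
  -- The entrywise `ℓ¹` norm is a crude bound of the operator norm; it suffices because the size is
  -- fixed.
  have hbound : ∀ (C D : Matrix ι ι ℂ) (x : EuclideanSpace ℂ ι),
      (inner ℂ (Matrix.toEuclideanLin C x) x).re ≤
        (inner ℂ (Matrix.toEuclideanLin D x) x).re + (∑ i, ∑ j, ‖C i j - D i j‖) * ‖x‖ ^ 2 := by
    intro C D x
    rw [re_inner_toEuclideanLin_eq, re_inner_toEuclideanLin_eq, ← sub_le_iff_le_add',
      ← Complex.sub_re, ← Finset.sum_sub_distrib, Finset.sum_mul]
    refine (Complex.re_le_norm _).trans ((norm_sum_le _ _).trans (Finset.sum_le_sum fun k _ => ?_))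
    rw [← Finset.sum_sub_distrib, Finset.sum_mul]
    refine (norm_sum_le _ _).trans (Finset.sum_le_sum fun l _ => ?_)
    rw [← sub_mul, ← sub_mul, norm_mul, norm_mul, mul_assoc, sq, RCLike.norm_conj]
    gcongr
    · exact PiLp.norm_apply_le x l
    · exact PiLp.norm_apply_le x k
  have hlim : Tendsto (fun M => ∑ i, ∑ j, ‖A M i j - B i j‖) atTop (𝓝 0) := by
    have := tendsto_finsetSum Finset.univ fun i _ => tendsto_finsetSum Finset.univ
      fun j _ => ((h i j).sub_const (B i j)).norm
    simpa using this
  rw [tendsto_iff_norm_sub_tendsto_zero]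
  refine squeeze_zero (fun _ => norm_nonneg _) (fun M => ?_) hlim
  rw [Real.norm_eq_abs, abs_sub_le_iff]
  constructor
  · rw [sub_le_iff_le_add']
    exact eigenvalues_le_add_of_forall_le _ _ _ _ (hbound (A M) B)
  · rw [sub_le_iff_le_add']
    refine eigenvalues_le_add_of_forall_le _ _ _ _ fun x => ?_
    have := hbound B (A M) x
    simpa only [norm_sub_rev (B _ _)] using this

/-! ### Negligible vectors of an isometry -/

section Negligible

variable {E : Type*} [NormedAddCommGroup E] [InnerProductSpace ℂ E] {V : E →ₗᵢ[ℂ] E}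

/-- The combination `∑_l conj c_l V^l g` of the orbit of `g`. -/
def orbitSum (V : E →ₗᵢ[ℂ] E) (g : E) {N : ℕ} (c : EuclideanSpace ℂ (Fin N)) : E :=
  ∑ l : Fin N, starRingEnd ℂ (c l) • (V ^ (l : ℕ)) g

/-- Vectors `g` for which the norm of `c ↦ ∑_{l ≤ N} conj c_l V^l g` is `o(√N)`. -/
def IsNegligible (V : E →ₗᵢ[ℂ] E) (g : E) : Prop :=
  ∀ ε > 0, ∀ᶠ N : ℕ in atTop, ∀ c : EuclideanSpace ℂ (Fin (N + 1)),
    ‖orbitSum V g c‖ ≤ ε * √(N + 1 : ℝ) * ‖c‖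

theorem pow_isometry_succ_apply (k : ℕ) (g : E) : (V ^ (k + 1)) g = V ((V ^ k) g) := by
  rw [pow_succ']; rfl

theorem pow_isometry_add_apply (j k : ℕ) (g : E) : (V ^ (j + k)) g = (V ^ j) ((V ^ k) g) := by
  rw [pow_add]; rfl

theorem pow_isometry_apply_of_eigenvector {v : E} {ξ : ℂ} (hv : V v = ξ • v) (k : ℕ) :
    (V ^ k) v = ξ ^ k • v := by
  induction k with
  | zero => simp
  | succ k ih => rw [pow_isometry_succ_apply, ih, map_smul, hv, smul_smul, pow_succ]

theorem norm_eigenvalue {v : E} {ξ : ℂ} (hv : V v = ξ • v) (hv0 : v ≠ 0) : ‖ξ‖ = 1 := by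
  have h := V.norm_map v
  rw [hv, norm_smul] at h
  exact mul_right_cancel₀ (norm_ne_zero_iff.2 hv0) (by rw [h, one_mul])

/-- An eigenvector of an isometry is also one of the adjoint, because its eigenvalue is unimodular.
-/
theorem inner_eigenvector_pow {v : E} {ξ : ℂ} (hv : V v = ξ • v) (hv0 : v ≠ 0) (k : ℕ) (g : E) :
    inner ℂ v ((V ^ k) g) = ξ ^ k * inner ℂ v g := by
  have hξ := norm_eigenvalue hv hv0
  have h1 : inner ℂ ((V ^ k) v) ((V ^ k) g) = inner ℂ v g := (V ^ k).inner_map_map v g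
  rw [pow_isometry_apply_of_eigenvector hv, inner_smul_left, map_pow] at h1
  rw [← h1, ← mul_assoc, ← mul_pow, Complex.mul_conj, Complex.normSq_eq_norm_sq, hξ]
  simp

theorem orbitSum_add (g h : E) {N : ℕ} (c : EuclideanSpace ℂ (Fin N)) :
    orbitSum V (g + h) c = orbitSum V g c + orbitSum V h c := by
  simp [orbitSum, Finset.sum_add_distrib]

theorem orbitSum_sum {ι : Type*} (s : Finset ι) (g : ι → E) {N : ℕ}
    (c : EuclideanSpace ℂ (Fin N)) :
    orbitSum V (∑ j ∈ s, g j) c = ∑ j ∈ s, orbitSum V (g j) c := by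
  simp only [orbitSum, map_sum, Finset.smul_sum]
  exact Finset.sum_comm

theorem IsNegligible.add {g h : E} (hg : IsNegligible V g) (hh : IsNegligible V h) :
    IsNegligible V (g + h) := by
  intro ε hε
  filter_upwards [hg (ε / 2) (half_pos hε), hh (ε / 2) (half_pos hε)] with N h1 h2 c
  rw [orbitSum_add]
  refine (norm_add_le _ _).trans ((add_le_add (h1 c) (h2 c)).trans (le_of_eq ?_))
  ring

/-- The trivial bound of an orbit sum. -/
theorem norm_orbitSum_le (g : E) (N : ℕ) (c : EuclideanSpace ℂ (Fin (N + 1))) :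
    ‖orbitSum V g c‖ ≤ ‖g‖ * √(N + 1 : ℝ) * ‖c‖ := by
  have h1 : ‖orbitSum V g c‖ ≤ (∑ l, ‖c l‖) * ‖g‖ := by
    rw [orbitSum, Finset.sum_mul]
    refine (norm_sum_le _ _).trans (le_of_eq (Finset.sum_congr rfl fun l _ => ?_))
    rw [norm_smul, RCLike.norm_conj, (V ^ (l : ℕ)).norm_map]
  have h2 : ∑ l, ‖c l‖ ≤ √(N + 1 : ℝ) * ‖c‖ := by
    refine abs_le_of_sq_le_sq' ?_ (by positivity) |>.2
    rw [mul_pow, Real.sq_sqrt (by positivity), EuclideanSpace.norm_sq_eq]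
    simpa using sq_sum_le_card_mul_sum_sq (s := Finset.univ) (f := fun l => ‖c l‖)
  calc ‖orbitSum V g c‖ ≤ (∑ l, ‖c l‖) * ‖g‖ := h1
    _ ≤ (√(N + 1 : ℝ) * ‖c‖) * ‖g‖ := by gcongr
    _ = _ := by ring

/-- With truncated subtraction `(j - k) + (k - j)` is `|j - k|`: an isometry makes the Gram matrix
Toeplitz. -/
theorem norm_inner_pow_pow (g : E) (j k : ℕ) :
    ‖inner ℂ ((V ^ j) g) ((V ^ k) g)‖ = ‖inner ℂ g ((V ^ ((j - k) + (k - j))) g)‖ := by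
  rcases le_total j k with h | h
  · obtain ⟨d, rfl⟩ := Nat.exists_eq_add_of_le h
    rw [pow_isometry_add_apply, (V ^ j).inner_map_map]
    congr 4
    omega
  · obtain ⟨d, rfl⟩ := Nat.exists_eq_add_of_le h
    rw [pow_isometry_add_apply, (V ^ k).inner_map_map, ← inner_conj_symm, RCLike.norm_conj]
    congr 4
    omega

/-- Each distance to `j` is attained at most twice. -/
theorem sum_dist_le (ρ : ℕ → ℝ) (hρ : ∀ l, 0 ≤ ρ l) (N j : ℕ) (hj : j < N + 1) :
    ∑ k : Fin (N + 1), ρ ((j - k) + (k - j)) ≤ 2 * ∑ l ∈ Finset.range (N + 1), ρ l := by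
  rw [Fin.sum_univ_eq_sum_range (fun k => ρ ((j - k) + (k - j)))]
  have hsplit : ∑ k ∈ Finset.range (N + 1), ρ ((j - k) + (k - j)) ≤
      ∑ k ∈ Finset.range (j + 1), ρ (j - k) + ∑ k ∈ Finset.range (N + 1 - j), ρ k := by
    have hN : N + 1 = j + (N + 1 - j) := by omega
    rw [hN, Finset.sum_range_add, ← hN]
    refine add_le_add ?_ (le_of_eq ?_)
    · rw [Finset.sum_range_succ]
      refine le_add_of_le_of_nonneg (le_of_eq (Finset.sum_congr rfl fun k hk => ?_)) (hρ _)
      have := Finset.mem_range.1 hk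
      congr 1
      omega
    · refine Finset.sum_congr rfl fun k _ => ?_
      congr 1
      omega
  have h1 : ∑ k ∈ Finset.range (j + 1), ρ (j - k) = ∑ k ∈ Finset.range (j + 1), ρ k := by
    have := Finset.sum_range_reflect ρ (j + 1)
    simpa using this
  have h2 : ∑ k ∈ Finset.range (j + 1), ρ k ≤ ∑ l ∈ Finset.range (N + 1), ρ l :=
    Finset.sum_le_sum_of_subset_of_nonneg (Finset.range_mono (by omega)) fun _ _ _ => hρ _
  have h3 : ∑ k ∈ Finset.range (N + 1 - j), ρ k ≤ ∑ l ∈ Finset.range (N + 1), ρ l :=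
    Finset.sum_le_sum_of_subset_of_nonneg (Finset.range_mono (by omega)) fun _ _ _ => hρ _
  rw [h1] at hsplit
  linarith

/-- Schur's test for the Gram matrix of an orbit. -/
theorem norm_orbitSum_sq_le (g : E) (N : ℕ) (c : EuclideanSpace ℂ (Fin (N + 1))) :
    ‖orbitSum V g c‖ ^ 2 ≤
      (2 * ∑ l ∈ Finset.range (N + 1), ‖inner ℂ g ((V ^ l) g)‖) * ‖c‖ ^ 2 := by
  set ρ : ℕ → ℝ := fun l => ‖inner ℂ g ((V ^ l) g)‖ with hρ
  set S := 2 * ∑ l ∈ Finset.range (N + 1), ρ l with hS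
  have h0 : ‖orbitSum V g c‖ ^ 2 ≤
      ∑ j : Fin (N + 1), ∑ k : Fin (N + 1), ‖c j‖ * ‖c k‖ * ρ (((j : ℕ) - k) + ((k : ℕ) - j)) := by
    have h : ‖orbitSum V g c‖ ^ 2 = ‖inner ℂ (orbitSum V g c) (orbitSum V g c)‖ := by
      rw [inner_self_eq_norm_sq_to_K]
      simp
    rw [h, orbitSum, sum_inner]
    refine (norm_sum_le _ _).trans (Finset.sum_le_sum fun j _ => ?_)
    rw [inner_sum]
    refine (norm_sum_le _ _).trans (Finset.sum_le_sum fun k _ => le_of_eq ?_)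
    rw [inner_smul_left, inner_smul_right, norm_mul, norm_mul, norm_inner_pow_pow, mul_assoc,
      starRingEnd_self_apply, RCLike.norm_conj]
  -- The arithmetic-geometric mean inequality. The distance in the second term is written reversed,
  -- so that exchanging the two sums turns it into the first.
  have h1 : ∀ j k : Fin (N + 1), ‖c j‖ * ‖c k‖ * ρ (((j : ℕ) - k) + ((k : ℕ) - j)) ≤
      (‖c j‖ ^ 2 * ρ (((j : ℕ) - k) + ((k : ℕ) - j)) +
        ‖c k‖ ^ 2 * ρ (((k : ℕ) - j) + ((j : ℕ) - k))) / 2 := by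
    intro j k
    rw [add_comm ((k : ℕ) - j)]
    have := two_mul_le_add_sq ‖c j‖ ‖c k‖
    have h3 : 0 ≤ ρ (((j : ℕ) - k) + ((k : ℕ) - j)) := norm_nonneg _
    nlinarith
  have h2 : ∑ j : Fin (N + 1), ∑ k : Fin (N + 1),
      ‖c j‖ ^ 2 * ρ (((j : ℕ) - k) + ((k : ℕ) - j)) ≤ S * ‖c‖ ^ 2 := by
    rw [EuclideanSpace.norm_sq_eq, Finset.mul_sum]
    refine Finset.sum_le_sum fun j _ => ?_
    rw [← Finset.mul_sum, mul_comm]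
    exact mul_le_mul_of_nonneg_right (sum_dist_le ρ (fun _ => norm_nonneg _) N j j.2)
      (by positivity)
  have h3 : ∑ j : Fin (N + 1), ∑ k : Fin (N + 1),
      ‖c k‖ ^ 2 * ρ (((k : ℕ) - j) + ((j : ℕ) - k)) ≤ S * ‖c‖ ^ 2 := by
    rw [Finset.sum_comm]
    exact h2
  refine h0.trans ((Finset.sum_le_sum fun j _ => Finset.sum_le_sum fun k _ => h1 j k).trans ?_)
  simp only [← Finset.sum_div, Finset.sum_add_distrib]
  linarith

/-- A vector whose autocorrelations tend to zero in quadratic mean is negligible. -/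
theorem isNegligible_of_tendsto {g : E}
    (h : Tendsto (fun N : ℕ => (∑ l ∈ Finset.range (N + 1), ‖inner ℂ g ((V ^ l) g)‖ ^ 2) /
      (N + 1 : ℝ)) atTop (𝓝 0)) : IsNegligible V g := by
  intro ε hε
  -- By Cauchy–Schwarz `S ^ 2 ≤ (N + 1) ^ 2 * (ε ^ 4 / 4)`, hence `2 * S ≤ ε ^ 2 * (N + 1)`, the
  -- bound needed in Schur's test.
  have hε' : 0 < ε ^ 4 / 4 := by positivity
  filter_upwards [h.eventually (gt_mem_nhds hε')] with N hN c
  have hN1 : (0 : ℝ) < N + 1 := by positivity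
  set S := ∑ l ∈ Finset.range (N + 1), ‖inner ℂ g ((V ^ l) g)‖ with hS
  have h1 : S ^ 2 ≤ (N + 1 : ℝ) * ∑ l ∈ Finset.range (N + 1), ‖inner ℂ g ((V ^ l) g)‖ ^ 2 := by
    simpa using sq_sum_le_card_mul_sum_sq (s := Finset.range (N + 1))
      (f := fun l => ‖inner ℂ g ((V ^ l) g)‖)
  rw [div_lt_iff₀ hN1] at hN
  have h2 : S ≤ ε ^ 2 / 2 * (N + 1 : ℝ) := by
    refine abs_le_of_sq_le_sq' ?_ (by positivity) |>.2
    nlinarith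
  refine abs_le_of_sq_le_sq' ?_ (by positivity) |>.2
  refine (norm_orbitSum_sq_le g N c).trans ?_
  rw [mul_pow, mul_pow, Real.sq_sqrt hN1.le]
  exact mul_le_mul_of_nonneg_right (by linarith) (by positivity)

/-- Negligible vectors are orthogonal to eigenvectors. -/
theorem IsNegligible.inner_eigenvector {g v : E} (hg : IsNegligible V g) {ξ : ℂ}
    (hv : V v = ξ • v) : inner ℂ v g = 0 := by
  by_cases hv0 : v = 0
  · simp [hv0]
  have hξ := norm_eigenvalue hv hv0
  rw [← norm_le_zero_iff]
  refine le_of_forall_pos_le_add fun ε hε => ?_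
  have hvpos : 0 < ‖v‖ := norm_pos_iff.2 hv0
  obtain ⟨N, hN⟩ := (hg (ε / ‖v‖) (by positivity)).exists
  have hN1 : (0 : ℝ) < N + 1 := by positivity
  -- These coefficients cancel the phases of the orbit along `v`: the inner product with `v` grows
  -- like `N + 1`, while negligibility allows only `ε * (N + 1)`.
  set c : EuclideanSpace ℂ (Fin (N + 1)) := WithLp.toLp 2 fun l => ξ ^ (l : ℕ) with hc
  have hcn : ‖c‖ = √(N + 1 : ℝ) := by
    rw [EuclideanSpace.norm_eq]
    simp [hc, hξ]
  have h1 : inner ℂ v (orbitSum V g c) = (N + 1 : ℝ) * inner ℂ v g := by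
    simp only [orbitSum, inner_sum, inner_smul_right, inner_eigenvector_pow hv hv0, hc]
    have : ∀ l : Fin (N + 1), starRingEnd ℂ (ξ ^ (l : ℕ)) * (ξ ^ (l : ℕ) * inner ℂ v g) =
        inner ℂ v g := by
      intro l
      rw [← mul_assoc, mul_comm (starRingEnd ℂ _), Complex.mul_conj, Complex.normSq_eq_norm_sq,
        norm_pow, hξ]
      simp
    rw [Finset.sum_congr rfl fun l _ => this l]
    simp
  have h2 : (N + 1 : ℝ) * ‖inner ℂ v g‖ ≤ ‖v‖ * (ε / ‖v‖ * √(N + 1 : ℝ) * √(N + 1 : ℝ)) := by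
    have h3 := (norm_inner_le_norm (𝕜 := ℂ) v (orbitSum V g c)).trans
      (mul_le_mul_of_nonneg_left (hN c) (norm_nonneg v))
    rw [h1, norm_mul, hcn, Complex.norm_real, Real.norm_of_nonneg hN1.le] at h3
    exact h3
  rw [mul_assoc (ε / ‖v‖), Real.mul_self_sqrt hN1.le] at h2
  have h4 : ‖v‖ * (ε / ‖v‖ * (N + 1 : ℝ)) = (N + 1 : ℝ) * ε := by field_simp
  rw [h4] at h2
  rw [zero_add]
  exact le_of_mul_le_mul_left h2 hN1

/-- On the completely non-unitary part the autocorrelations tend to zero. -/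
theorem tendsto_inner_pow_of_mem_nonUnitaryPart [CompleteSpace E] {g : E}
    (hg : g ∈ nonUnitaryPart V) : Tendsto (fun l : ℕ => inner ℂ g ((V ^ l) g)) atTop (𝓝 0) := by
  have hclosed : ∀ k : ℕ, IsClosed (LinearMap.range (V ^ k).toLinearMap : Set E) := fun k =>
    (V ^ k).isometry.isClosedEmbedding.isClosed_range
  -- Thus the non-unitary part is the closure of the increasing union of the complements of the
  -- ranges of `V ^ k`.
  have hU : unitaryPart V = (⨆ k : ℕ, (LinearMap.range (V ^ k).toLinearMap)ᗮ)ᗮ := by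
    rw [← Submodule.iInf_orthogonal, unitaryPart]
    refine iInf_congr fun k => ?_
    rw [Submodule.orthogonal_orthogonal_eq_closure]
    exact ((hclosed k).submodule_topologicalClosure_eq).symm
  have hmono : Monotone fun k : ℕ => (LinearMap.range (V ^ k).toLinearMap)ᗮ := by
    refine monotone_nat_of_le_succ fun k => Submodule.orthogonal_le ?_
    rintro _ ⟨x, rfl⟩
    exact ⟨V x, by rw [pow_succ]; rfl⟩
  rw [nonUnitaryPart, hU, Submodule.orthogonal_orthogonal_eq_closure,
    ← SetLike.mem_coe, Submodule.topologicalClosure_coe, Metric.mem_closure_iff] at hg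
  rw [Metric.tendsto_atTop]
  intro ε hε
  have hε' : 0 < ε / (‖g‖ + 1) := by positivity
  obtain ⟨y, hy, hgy⟩ := hg _ hε'
  rw [SetLike.mem_coe, Submodule.mem_iSup_of_directed _ hmono.directed_le] at hy
  obtain ⟨k, hk⟩ := hy
  refine ⟨k, fun l hl => ?_⟩
  -- The approximant `y` is orthogonal to the range of `V ^ k`, which contains `(V ^ l) g` once `l ≥
  -- k`.
  have h0 : inner ℂ y ((V ^ l) g) = 0 := by
    exact (Submodule.mem_orthogonal' _ _).1 (hmono hl hk) _ ⟨g, rfl⟩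
  have h1 : inner ℂ g ((V ^ l) g) = inner ℂ (g - y) ((V ^ l) g) := by
    rw [inner_sub_left, h0, sub_zero]
  rw [dist_zero_right, h1]
  rw [dist_eq_norm] at hgy
  calc ‖inner ℂ (g - y) ((V ^ l) g)‖ ≤ ‖g - y‖ * ‖g‖ := by
        rw [← (V ^ l).norm_map g]
        exact norm_inner_le_norm (𝕜 := ℂ) (g - y) ((V ^ l) g)
    _ ≤ ε / (‖g‖ + 1) * ‖g‖ := by gcongr
    _ < ε / (‖g‖ + 1) * (‖g‖ + 1) := by gcongr; linarith
    _ = ε := by field_simp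

theorem isNegligible_of_mem_nonUnitaryPart [CompleteSpace E] {g : E}
    (hg : g ∈ nonUnitaryPart V) : IsNegligible V g := by
  apply isNegligible_of_tendsto
  have h1 : Tendsto (fun l : ℕ => ‖inner ℂ g ((V ^ l) g)‖ ^ 2) atTop (𝓝 0) := by
    simpa using (tendsto_inner_pow_of_mem_nonUnitaryPart hg).norm.pow 2
  have h2 := (tendsto_add_atTop_iff_nat 1).2 h1.cesaro
  refine h2.congr fun N => ?_
  push_cast
  rw [div_eq_inv_mul]

/-! ### Wiener's lemma and the continuous spectrum. -/

theorem norm_geom_sum_le {q : ℂ} (hq : ‖q‖ = 1) (hq1 : q ≠ 1) (N : ℕ) :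
    ‖∑ l ∈ Finset.range N, q ^ l‖ ≤ 2 / ‖q - 1‖ := by
  rw [geom_sum_eq hq1, norm_div]
  gcongr
  refine (norm_sub_le _ _).trans ?_
  rw [norm_pow, hq]
  norm_num

/-- **Wiener's lemma**: the Fourier coefficients of a measure without atoms tend to zero in
quadratic mean. -/
theorem tendsto_average_norm_sq_integral_pow {ν : Measure Circle} [IsFiniteMeasure ν]
    (hν : ∀ z : Circle, ν {z} = 0) :
    Tendsto (fun N : ℕ => (∑ l ∈ Finset.range (N + 1), ‖∫ z : Circle, (z : ℂ) ^ l ∂ν‖ ^ 2) /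
      (N + 1 : ℝ)) atTop (𝓝 0) := by
  -- By Fubini the integral of `F N` over `ν × ν` is the average of the squared Fourier
  -- coefficients. Off the diagonal `F N` tends to zero, and the diagonal is null because `ν` has no
  -- atoms.
  set F : ℕ → Circle × Circle → ℂ := fun N p =>
    (∑ l ∈ Finset.range (N + 1), ((p.1 : ℂ) * starRingEnd ℂ (p.2 : ℂ)) ^ l) / (N + 1 : ℂ) with hF
  have hcont : ∀ N, Continuous (F N) := fun N => by
    simp only [hF]
    fun_prop
  have hnorm : ∀ p : Circle × Circle, ‖(p.1 : ℂ) * starRingEnd ℂ (p.2 : ℂ)‖ = 1 := fun p => by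
    rw [norm_mul, RCLike.norm_conj, Circle.norm_coe, Circle.norm_coe, one_mul]
  have hN1 : ∀ N : ℕ, ‖(N + 1 : ℂ)‖ = N + 1 := fun N => by
    have : (N + 1 : ℂ) = ((N + 1 : ℝ) : ℂ) := by push_cast; rfl
    rw [this, Complex.norm_real, Real.norm_of_nonneg (by positivity)]
  have hdiag : ∀ᵐ p ∂(ν.prod ν), p.1 ≠ p.2 := by
    rw [ae_iff]
    have hm : MeasurableSet {p : Circle × Circle | ¬ p.1 ≠ p.2} := by
      simp only [not_not]
      exact (isClosed_diagonal (X := Circle)).measurableSet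
    rw [Measure.prod_apply hm]
    have : ∀ z : Circle, Prod.mk z ⁻¹' {p : Circle × Circle | ¬ p.1 ≠ p.2} = {z} := by
      intro z
      ext w
      simp [eq_comm]
    simp only [this, hν, lintegral_zero]
  have hlim : Tendsto (fun N => ∫ p, F N p ∂(ν.prod ν)) atTop (𝓝 (∫ _, (0 : ℂ) ∂(ν.prod ν))) := by
    refine tendsto_integral_of_dominated_convergence (fun _ => (1 : ℝ))
      (fun N => (hcont N).aestronglyMeasurable) (integrable_const _) (fun N => ?_) ?_
    · refine Eventually.of_forall fun p => ?_
      simp only [hF, norm_div, hN1]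
      rw [div_le_one (by positivity)]
      refine (norm_sum_le _ _).trans ?_
      simp only [norm_pow, hnorm]
      simp
    · filter_upwards [hdiag] with p hp
      have hq : (p.1 : ℂ) * starRingEnd ℂ (p.2 : ℂ) ≠ 1 := by
        intro h
        apply hp
        rw [← Circle.coe_inv_eq_conj, ← Circle.coe_mul] at h
        exact mul_inv_eq_one.1 (Circle.coe_injective (by simpa using h))
      refine squeeze_zero_norm (a := fun N : ℕ =>
        2 / ‖(p.1 : ℂ) * starRingEnd ℂ (p.2 : ℂ) - 1‖ * (1 / (N + 1 : ℝ))) (fun N => ?_) ?_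
      · simp only [hF, norm_div, hN1]
        rw [mul_one_div]
        gcongr
        exact norm_geom_sum_le (hnorm p) hq _
      · simpa using tendsto_one_div_add_atTop_nhds_zero_nat.const_mul
          (2 / ‖(p.1 : ℂ) * starRingEnd ℂ (p.2 : ℂ) - 1‖)
  have hval : ∀ N : ℕ, ∫ p, F N p ∂(ν.prod ν) =
      (((∑ l ∈ Finset.range (N + 1), ‖∫ z : Circle, (z : ℂ) ^ l ∂ν‖ ^ 2) / (N + 1 : ℝ) : ℝ) : ℂ) := by
    intro N
    simp only [hF]
    rw [integral_div, integral_finsetSum]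
    · push_cast
      congr 1
      refine Finset.sum_congr rfl fun l _ => ?_
      simp only [mul_pow]
      rw [integral_prod_mul (fun z : Circle => (z : ℂ) ^ l)
        (fun w : Circle => starRingEnd ℂ (w : ℂ) ^ l)]
      simp only [← map_pow]
      rw [integral_conj, Complex.mul_conj, Complex.normSq_eq_norm_sq]
      push_cast
      rfl
    · intro l _
      refine Integrable.of_bound (C := 1) (by fun_prop) (Eventually.of_forall fun p => ?_)
      rw [norm_pow, hnorm, one_pow]
  have h := (Complex.continuous_re.tendsto _).comp hlim
  simp only [integral_zero, Complex.zero_re] at h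
  refine h.congr fun N => ?_
  rw [Function.comp_apply, hval, Complex.ofReal_re]

theorem IsSpectralMeasure.isNegligible {g : E} {ν : Measure Circle} (h : IsSpectralMeasure V g ν)
    (hν : ∀ z : Circle, ν {z} = 0) : IsNegligible V g := by
  have := h.1
  apply isNegligible_of_tendsto
  simpa only [h.2] using tendsto_average_norm_sq_integral_pow hν

/-- The exponential is injective on `(-π, π]`, so the preimage of a point has at most one element.
-/
theorem arcLength_singleton (z : Circle) : arcLength {z} = 0 := by
  rw [arcLength, Measure.map_apply (by fun_prop) (measurableSet_singleton z),
    Measure.restrict_apply (Circle.exp.continuous.measurable (measurableSet_singleton z))]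
  refine Set.Subsingleton.measure_zero (fun x hx y hy => ?_) _
  have h : Circle.exp x = Circle.exp y := hx.1.trans hy.1.symm
  rw [← Circle.arg_exp hx.2.1 hx.2.2, h, Circle.arg_exp hy.2.1 hy.2.2]

theorem isNegligible_of_mem_absolutelyContinuousPart {g : E}
    (hg : g ∈ absolutelyContinuousPart V) : IsNegligible V g := by
  obtain ⟨-, ν, hν, hac⟩ := hg
  exact hν.isNegligible fun z => hac (arcLength_singleton z)

theorem isNegligible_of_mem_singularContinuousPart {g : E}
    (hg : g ∈ singularContinuousPart V) : IsNegligible V g := by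
  obtain ⟨-, ν, hν, hat, -⟩ := hg
  exact hν.isNegligible hat

end Negligible

/-! ### Almost orthogonal families -/

section AlmostOrthogonal

variable {F : Type*} [NormedAddCommGroup F] [InnerProductSpace ℂ F] {ι : Type*} [Fintype ι]
  {e : ι → F} {D C : ℝ}

/-- The Gram matrix of the `e j` is `D` times the identity plus an off-diagonal part, whose form is
at most `C * (∑ ‖s j‖) ^ 2`; Cauchy–Schwarz gives the cardinality. -/
theorem abs_norm_sum_smul_sq_sub_le (he : ∀ j, ‖e j‖ ^ 2 = D) (hC : 0 ≤ C)
    (hoff : ∀ j k, j ≠ k → ‖inner ℂ (e j) (e k)‖ ≤ C) (s : ι → ℂ) :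
    |‖∑ j, s j • e j‖ ^ 2 - D * ∑ j, ‖s j‖ ^ 2| ≤ C * Fintype.card ι * ∑ j, ‖s j‖ ^ 2 := by
  classical
  have h1 : ((‖∑ j, s j • e j‖ ^ 2 - D * ∑ j, ‖s j‖ ^ 2 : ℝ) : ℂ) =
      ∑ j, ∑ k, if j = k then 0 else starRingEnd ℂ (s j) * s k * inner ℂ (e j) (e k) := by
    have h2 : ((‖∑ j, s j • e j‖ ^ 2 : ℝ) : ℂ) =
        ∑ j, ∑ k, starRingEnd ℂ (s j) * s k * inner ℂ (e j) (e k) := by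
      have := inner_self_eq_norm_sq_to_K (𝕜 := ℂ) (∑ j, s j • e j)
      push_cast
      rw [← Complex.coe_algebraMap, ← RCLike.algebraMap_eq_ofReal] at *
      rw [← this, sum_inner]
      simp only [inner_sum, inner_smul_left, inner_smul_right]
      exact Finset.sum_congr rfl fun j _ => Finset.sum_congr rfl fun k _ => by ring
    have h3 : ((D * ∑ j, ‖s j‖ ^ 2 : ℝ) : ℂ) =
        ∑ j, ∑ k, if j = k then starRingEnd ℂ (s j) * s k * inner ℂ (e j) (e k) else 0 := by
      simp only [Finset.sum_ite_eq, Finset.mem_univ, if_true]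
      push_cast
      rw [Finset.mul_sum]
      refine Finset.sum_congr rfl fun j _ => ?_
      rw [inner_self_eq_norm_sq_to_K, mul_comm (starRingEnd ℂ (s j)), Complex.mul_conj,
        Complex.normSq_eq_norm_sq, ← he j]
      push_cast
      exact mul_comm _ _
    rw [Complex.ofReal_sub, h2, h3, ← Finset.sum_sub_distrib]
    refine Finset.sum_congr rfl fun j _ => ?_
    rw [← Finset.sum_sub_distrib]
    refine Finset.sum_congr rfl fun k _ => ?_
    split_ifs <;> simp
  rw [← Real.norm_eq_abs, ← Complex.norm_real, h1]
  have h4 : ‖∑ j, ∑ k, if j = k then 0 else starRingEnd ℂ (s j) * s k * inner ℂ (e j) (e k)‖ ≤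
      ∑ j, ∑ k, C * (‖s j‖ * ‖s k‖) := by
    refine (norm_sum_le _ _).trans (Finset.sum_le_sum fun j _ =>
      (norm_sum_le _ _).trans (Finset.sum_le_sum fun k _ => ?_))
    split_ifs with hjk
    · rw [norm_zero]
      positivity
    · rw [norm_mul, norm_mul, RCLike.norm_conj, mul_comm]
      exact mul_le_mul_of_nonneg_right (hoff j k hjk) (by positivity)
  refine h4.trans ?_
  simp only [← Finset.mul_sum]
  rw [← Finset.sum_mul, mul_assoc, ← sq]
  refine mul_le_mul_of_nonneg_left ?_ hC
  simpa using sq_sum_le_card_mul_sum_sq (s := Finset.univ) (f := fun j => ‖s j‖)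

/-- Bessel's inequality for an almost orthogonal family: a bound of `s ↦ ∑ s j • e j` is a bound of
its adjoint, seen by inserting `s j = inner ℂ (e j) c`. -/
theorem sum_norm_inner_sq_le (hDC : 0 ≤ D + C)
    (h : ∀ s : ι → ℂ, |‖∑ j, s j • e j‖ ^ 2 - D * ∑ j, ‖s j‖ ^ 2| ≤ C * ∑ j, ‖s j‖ ^ 2) (c : F) :
    ∑ j, ‖inner ℂ c (e j)‖ ^ 2 ≤ (D + C) * ‖c‖ ^ 2 := by
  set s : ι → ℂ := fun j => inner ℂ (e j) c with hs
  have hsn : ∀ j, ‖inner ℂ c (e j)‖ = ‖s j‖ := fun j => norm_inner_symm _ _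
  simp only [hsn]
  set Q := ∑ j, ‖s j‖ ^ 2 with hQ
  have hQ0 : 0 ≤ Q := by positivity
  set y := ∑ j, s j • e j with hy
  have h1 : Q ≤ ‖y‖ * ‖c‖ := by
    have h2 : inner ℂ y c = (Q : ℂ) := by
      rw [hy, sum_inner, hQ]
      push_cast
      refine Finset.sum_congr rfl fun j _ => ?_
      rw [inner_smul_left, mul_comm, ← Complex.ofReal_pow, ← Complex.normSq_eq_norm_sq,
        ← Complex.mul_conj]
    have h3 := norm_inner_le_norm (𝕜 := ℂ) y c
    rwa [h2, Complex.norm_real, Real.norm_of_nonneg hQ0] at h3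
  have h4 : ‖y‖ ^ 2 ≤ (D + C) * Q := by
    have := (abs_le.1 (h s)).2
    linarith
  rcases hQ0.eq_or_lt with h0 | hpos
  · rw [← h0]
    positivity
  · refine le_of_mul_le_mul_left ?_ hpos
    calc Q * Q ≤ (‖y‖ * ‖c‖) * (‖y‖ * ‖c‖) := by gcongr
      _ = ‖y‖ ^ 2 * ‖c‖ ^ 2 := by ring
      _ ≤ (D + C) * Q * ‖c‖ ^ 2 := by gcongr
      _ = Q * ((D + C) * ‖c‖ ^ 2) := by ring

/-- The reverse bound holds only on the span of the `e j`. Cauchy–Schwarz applied to `‖c‖ ^ 2 = ∑ s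
j * inner ℂ c (e j)` reduces it to the lower bound of `‖c‖ ^ 2` by the coefficients. -/
theorem mul_norm_sq_le_sum_norm_inner_sq (hDC : 0 ≤ D - C)
    (h : ∀ s : ι → ℂ, |‖∑ j, s j • e j‖ ^ 2 - D * ∑ j, ‖s j‖ ^ 2| ≤ C * ∑ j, ‖s j‖ ^ 2)
    (s : ι → ℂ) :
    (D - C) * ‖∑ j, s j • e j‖ ^ 2 ≤ ∑ j, ‖inner ℂ (∑ k, s k • e k) (e j)‖ ^ 2 := by
  set c := ∑ j, s j • e j with hc
  set Q := ∑ j, ‖inner ℂ c (e j)‖ ^ 2 with hQ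
  have hQ0 : 0 ≤ Q := by positivity
  have h1 : ‖c‖ ^ 2 ≤ ∑ j, ‖s j‖ * ‖inner ℂ c (e j)‖ := by
    have h2 : inner ℂ c c = ∑ j, s j * inner ℂ c (e j) := by
      conv_lhs => enter [3]; rw [hc]
      simp only [inner_sum, inner_smul_right]
    have h3 : ‖inner ℂ c c‖ = ‖c‖ ^ 2 := by
      rw [inner_self_eq_norm_sq_to_K]
      simp
    rw [← h3, h2]
    refine (norm_sum_le _ _).trans (le_of_eq ?_)
    simp
  have h4 : (‖c‖ ^ 2) ^ 2 ≤ (∑ j, ‖s j‖ ^ 2) * Q :=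
    (pow_le_pow_left₀ (by positivity) h1 2).trans (Finset.sum_mul_sq_le_sq_mul_sq _ _ _)
  have h5 : (D - C) * ∑ j, ‖s j‖ ^ 2 ≤ ‖c‖ ^ 2 := by
    have := (abs_le.1 (h s)).1
    linarith
  rcases (sq_nonneg ‖c‖).eq_or_lt with h0 | hpos
  · rw [← h0, mul_zero]
    exact hQ0
  · refine le_of_mul_le_mul_left ?_ hpos
    calc ‖c‖ ^ 2 * ((D - C) * ‖c‖ ^ 2) = (D - C) * (‖c‖ ^ 2) ^ 2 := by ring
      _ ≤ (D - C) * ((∑ j, ‖s j‖ ^ 2) * Q) := by gcongr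
      _ = ((D - C) * ∑ j, ‖s j‖ ^ 2) * Q := by ring
      _ ≤ ‖c‖ ^ 2 * Q := by gcongr

end AlmostOrthogonal

/-- The vector `(1, ξ, …, ξ^{N-1})`. -/
def expVec (ξ : ℂ) (N : ℕ) : EuclideanSpace ℂ (Fin N) := WithLp.toLp 2 fun l => ξ ^ (l : ℕ)

theorem norm_expVec_sq {ξ : ℂ} (hξ : ‖ξ‖ = 1) (N : ℕ) : ‖expVec ξ N‖ ^ 2 = N := by
  rw [EuclideanSpace.norm_sq_eq]
  simp [expVec, hξ]

theorem inner_expVec (c : ℂ) (ξ : ℂ) (N : ℕ) :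
    inner ℂ (expVec ξ N) (expVec c N) = ∑ l ∈ Finset.range N, (c * starRingEnd ℂ ξ) ^ l := by
  rw [PiLp.inner_apply, ← Fin.sum_univ_eq_sum_range (fun l => (c * starRingEnd ℂ ξ) ^ l)]
  simp [expVec, mul_pow]

/-- Distinct exponential vectors are almost orthogonal, uniformly in their length. -/
theorem exists_almostOrthogonal_expVec {ι : Type*} [Fintype ι] {ξ : ι → ℂ}
    (hinj : Function.Injective ξ) (hξ : ∀ j, ‖ξ j‖ = 1) :
    ∃ C : ℝ, 0 ≤ C ∧ ∀ (N : ℕ) (s : ι → ℂ),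
      |‖∑ j, s j • expVec (ξ j) N‖ ^ 2 - N * ∑ j, ‖s j‖ ^ 2| ≤ C * ∑ j, ‖s j‖ ^ 2 := by
  -- The sum of all geometric-sum bounds dominates each of them, for every `N`; the diagonal terms
  -- are `2 / 0 = 0`.
  set B : ℝ := ∑ j, ∑ k, 2 / ‖ξ k * starRingEnd ℂ (ξ j) - 1‖ with hB
  have hB0 : 0 ≤ B := by positivity
  refine ⟨B * Fintype.card ι, by positivity, fun N s => ?_⟩
  refine abs_norm_sum_smul_sq_sub_le (fun j => norm_expVec_sq (hξ j) N) hB0 (fun j k hjk => ?_) s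
  rw [inner_expVec]
  have hne : ξ k * starRingEnd ℂ (ξ j) ≠ 1 := by
    intro h
    apply hjk
    apply hinj
    have h2 : ξ k * (starRingEnd ℂ (ξ j) * ξ j) = ξ j := by rw [← mul_assoc, h, one_mul]
    rw [mul_comm (starRingEnd ℂ _), Complex.mul_conj, Complex.normSq_eq_norm_sq, hξ j] at h2
    simpa using h2.symm
  refine (norm_geom_sum_le (by rw [norm_mul, RCLike.norm_conj, hξ, hξ, one_mul]) hne N).trans ?_
  refine (Finset.single_le_sum (f := fun k => 2 / ‖ξ k * starRingEnd ℂ (ξ j) - 1‖)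
    (fun _ _ => by positivity) (Finset.mem_univ k)).trans ?_
  exact Finset.single_le_sum (f := fun j => ∑ k, 2 / ‖ξ k * starRingEnd ℂ (ξ j) - 1‖)
    (fun _ _ => by positivity) (Finset.mem_univ j)

/-! ### Gram matrices of orbits of an isometry -/

section Orbit

variable {E : Type*} [NormedAddCommGroup E] [InnerProductSpace ℂ E] {V : E →ₗᵢ[ℂ] E}

/-- The Gram matrix of `g, V g, …, V^N g`. -/
def orbitGram (V : E →ₗᵢ[ℂ] E) (g : E) (N : ℕ) : Matrix (Fin (N + 1)) (Fin (N + 1)) ℂ :=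
  Matrix.of fun i j => inner ℂ ((V ^ (j : ℕ)) g) ((V ^ (i : ℕ)) g)

theorem orbitGram_isHermitian (V : E →ₗᵢ[ℂ] E) (g : E) (N : ℕ) :
    (orbitGram V g N).IsHermitian := by
  ext i j
  simp [orbitGram, Matrix.conjTranspose_apply]

/-- The sorted eigenvalues of `orbitGram`, extended by zero. -/
def orbitGramEigenvalue (V : E →ₗᵢ[ℂ] E) (g : E) (N i : ℕ) : ℝ :=
  if h : i < N + 1 then (orbitGram_isHermitian V g N).eigenvalues₀ ⟨i, by simpa using h⟩ else 0

/-- This turns min-max bounds into norm bounds of orbit sums; the conjugates in `orbitSum` match the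
index order of `orbitGram`. -/
theorem re_inner_orbitGram (g : E) (N : ℕ) (x : EuclideanSpace ℂ (Fin (N + 1))) :
    (inner ℂ (Matrix.toEuclideanLin (orbitGram V g N) x) x).re = ‖orbitSum V g x‖ ^ 2 := by
  have h : (inner ℂ (orbitSum V g x) (orbitSum V g x)).re = ‖orbitSum V g x‖ ^ 2 := by
    rw [inner_self_eq_norm_sq_to_K]
    norm_cast
  rw [re_inner_toEuclideanLin_eq, ← h, orbitSum, inner_sum]
  congr 1
  refine Finset.sum_congr rfl fun i _ => ?_
  rw [sum_inner]
  refine Finset.sum_congr rfl fun j _ => ?_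
  rw [inner_smul_left, inner_smul_right, starRingEnd_self_apply]
  simp only [orbitGram, Matrix.of_apply]
  ring

/-- An eigenvector contributes an operator of rank one: only the component of `c` along `expVec ξ N`
matters. -/
theorem orbitSum_eigenvector {v : E} {ξ : ℂ} (hv : V v = ξ • v) {N : ℕ}
    (c : EuclideanSpace ℂ (Fin N)) : orbitSum V v c = inner ℂ c (expVec ξ N) • v := by
  simp only [orbitSum, pow_isometry_apply_of_eigenvector hv, smul_smul, ← Finset.sum_smul]
  rw [PiLp.inner_apply]
  simp [expVec, mul_comm]

theorem inner_eigenvector_orbitSum {v : E} {ξ : ℂ} (hv : V v = ξ • v) (hv0 : v ≠ 0) (g : E) {N : ℕ}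
    (c : EuclideanSpace ℂ (Fin N)) :
    inner ℂ v (orbitSum V g c) = inner ℂ c (expVec ξ N) * inner ℂ v g := by
  simp only [orbitSum, inner_sum, inner_smul_right, inner_eigenvector_pow hv hv0, ← mul_assoc,
    ← Finset.sum_mul]
  rw [PiLp.inner_apply]
  simp [expVec, mul_comm]

theorem orbitGramEigenvalue_nonneg (g : E) (N i : ℕ) : 0 ≤ orbitGramEigenvalue V g N i := by
  rw [orbitGramEigenvalue]
  split_ifs with h
  · refine le_eigenvalues_of_injective _ _ _ LinearMap.id Function.injective_id
      (by simpa using h) fun x => ?_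
    rw [LinearMap.id_apply, re_inner_orbitGram, zero_mul]
    positivity
  · exact le_rfl

/-- Lower bound of the `i`-th eigenvalue from `i + 1` eigenvectors of the isometry. -/
theorem exists_le_orbitGramEigenvalue {i : ℕ} {v : Fin (i + 1) → E} {ξ : Fin (i + 1) → ℂ}
    (hv : Orthonormal ℂ v) (hV : ∀ j, V (v j) = ξ j • v j) (hinj : Function.Injective ξ)
    {g : E} {α : ℝ} (hα0 : 0 ≤ α) (hα : ∀ j, α ≤ ‖inner ℂ (v j) g‖ ^ 2) :
    ∃ C : ℝ, ∀ᶠ N : ℕ in atTop, α * (N + 1 - C) ≤ orbitGramEigenvalue V g N i := by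
  have hv0 : ∀ j, v j ≠ 0 := fun j => hv.ne_zero j
  obtain ⟨C, hC0, hC⟩ := exists_almostOrthogonal_expVec hinj
    fun j => norm_eigenvalue (hV j) (hv0 j)
  refine ⟨C, ?_⟩
  -- The first condition makes the index `i` legitimate; the second makes `N + 1 - C` positive and
  -- so the exponential vectors independent.
  filter_upwards [eventually_gt_atTop i, eventually_gt_atTop ⌈C⌉₊] with N hN hNC
  have hi : i < N + 1 := by omega
  have hNC' : 0 < ((N + 1 : ℕ) : ℝ) - C := by
    have h2 := Nat.lt_of_ceil_lt hNC
    push_cast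
    linarith
  rw [orbitGramEigenvalue, dif_pos hi]
  let ψ : (Fin (i + 1) → ℂ) →ₗ[ℂ] EuclideanSpace ℂ (Fin (N + 1)) :=
    Fintype.linearCombination ℂ fun j => expVec (ξ j) (N + 1)
  have hψ : ∀ s, ψ s = ∑ j, s j • expVec (ξ j) (N + 1) := fun s => by
    simp [ψ, Fintype.linearCombination_apply]
  refine le_eigenvalues_of_injective _ _ _ ψ ?_ (by simp) fun s => ?_
  · rw [← LinearMap.ker_eq_bot, LinearMap.ker_eq_bot']
    intro s hs
    have h1 := (abs_le.1 (hC (N + 1) s)).1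
    rw [← hψ, hs, norm_zero] at h1
    have h2 : (((N + 1 : ℕ) : ℝ) - C) * ∑ j, ‖s j‖ ^ 2 ≤ 0 := by
      nlinarith
    have h3 : ∑ j, ‖s j‖ ^ 2 = 0 :=
      le_antisymm (nonpos_of_mul_nonpos_right h2 hNC') (by positivity)
    ext j
    have := (Finset.sum_eq_zero_iff_of_nonneg fun _ _ => by positivity).1 h3 j (Finset.mem_univ j)
    simpa using this
  · rw [re_inner_orbitGram, hψ]
    have h1 := mul_norm_sq_le_sum_norm_inner_sq hNC'.le (hC (N + 1)) s
    set c := ∑ j, s j • expVec (ξ j) (N + 1) with hc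
    -- Bessel's inequality discards everything in `g` except its components along the `v j`.
    have h2 : ∑ j, ‖inner ℂ (v j) (orbitSum V g c)‖ ^ 2 ≤ ‖orbitSum V g c‖ ^ 2 :=
      hv.sum_inner_products_le _
    refine le_trans ?_ h2
    calc α * ((N : ℝ) + 1 - C) * ‖c‖ ^ 2 = α * ((((N + 1 : ℕ) : ℝ) - C) * ‖c‖ ^ 2) := by
          push_cast
          ring
      _ ≤ α * ∑ j, ‖inner ℂ c (expVec (ξ j) (N + 1))‖ ^ 2 := by gcongr
      _ ≤ _ := by
        rw [Finset.mul_sum]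
        refine Finset.sum_le_sum fun j _ => ?_
        rw [inner_eigenvector_orbitSum (hV j) (hv0 j), norm_mul, mul_pow, mul_comm]
        exact mul_le_mul_of_nonneg_left (hα j) (by positivity)

/-- Upper bound of the `i`-th eigenvalue when the vector is a combination of `i` eigenvectors and
finitely many others with coefficients at most `A`, up to a small and a negligible vector. -/
theorem exists_orbitGramEigenvalue_le {i : ℕ} {u : Fin i → E} {κ : Fin i → ℂ}
    (hu : ∀ k, V (u k) = κ k • u k) {ι : Type*} [Fintype ι] {v : ι → E} {ξ : ι → ℂ}
    (hv : Orthonormal ℂ v) (hV : ∀ j, V (v j) = ξ j • v j) (hinj : Function.Injective ξ)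
    {b : ι → ℂ} {A : ℝ} (hA0 : 0 ≤ A) (hb : ∀ j, ‖b j‖ ≤ A) {g t h : E} (hh : IsNegligible V h)
    (hg : g = ∑ k, u k + ∑ j, b j • v j + t + h) {ε : ℝ} (hε : 0 < ε) (ht : ‖t‖ ≤ ε) :
    ∃ C : ℝ, 0 ≤ C ∧ ∀ᶠ N : ℕ in atTop, orbitGramEigenvalue V g N i ≤
      (A * √(N + 1 + C) + 2 * ε * √(N + 1 : ℝ)) ^ 2 := by
  obtain ⟨C, hC0, hC⟩ := exists_almostOrthogonal_expVec hinj
    fun j => norm_eigenvalue (hV j) (hv.ne_zero j)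
  refine ⟨C, hC0, ?_⟩
  filter_upwards [eventually_gt_atTop i, hh ε hε] with N hN hNh
  have hi : i < N + 1 := by omega
  rw [orbitGramEigenvalue, dif_pos hi]
  -- Orthogonality to the `i` exponential vectors kills the orbit sums of the `u k`.
  let φ : EuclideanSpace ℂ (Fin (N + 1)) →ₗ[ℂ] (Fin i → ℂ) :=
    LinearMap.pi fun k => (innerₛₗ ℂ (expVec (κ k) (N + 1)))
  refine eigenvalues_le_of_ker _ _ _ φ fun x hx => ?_
  rw [re_inner_orbitGram, ← mul_pow]
  refine pow_le_pow_left₀ (norm_nonneg _) ?_ 2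
  have h0 : ∀ k, orbitSum V (u k) x = 0 := by
    intro k
    have h1 : inner ℂ (expVec (κ k) (N + 1)) x = 0 := congrFun hx k
    rw [orbitSum_eigenvector (hu k), ← inner_conj_symm, h1, map_zero, zero_smul]
  have h1 : ‖∑ j, orbitSum V (b j • v j) x‖ ≤ A * √(N + 1 + C) * ‖x‖ := by
    have hval : ∀ j, orbitSum V (b j • v j) x = (inner ℂ x (expVec (ξ j) (N + 1)) * b j) • v j := by
      intro j
      rw [orbitSum_eigenvector (ξ := ξ j) (by rw [map_smul, hV, smul_comm]), smul_smul]
    simp only [hval]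
    refine abs_le_of_sq_le_sq' ?_ (by positivity) |>.2
    have hnorm : ‖∑ j, (inner ℂ x (expVec (ξ j) (N + 1)) * b j) • v j‖ ^ 2 =
        ∑ j, ‖inner ℂ x (expVec (ξ j) (N + 1)) * b j‖ ^ 2 := by
      have := hv.inner_sum (fun j => inner ℂ x (expVec (ξ j) (N + 1)) * b j)
        (fun j => inner ℂ x (expVec (ξ j) (N + 1)) * b j) Finset.univ
      rw [inner_self_eq_norm_sq_to_K] at this
      simp only [Complex.conj_mul'] at this
      apply Complex.ofReal_injective
      push_cast
      exact this
    rw [hnorm, mul_pow, mul_pow, Real.sq_sqrt (by positivity)]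
    have h2 := sum_norm_inner_sq_le (by positivity) (hC (N + 1)) x
    calc ∑ j, ‖inner ℂ x (expVec (ξ j) (N + 1)) * b j‖ ^ 2
        ≤ ∑ j, A ^ 2 * ‖inner ℂ x (expVec (ξ j) (N + 1))‖ ^ 2 := by
          refine Finset.sum_le_sum fun j _ => ?_
          rw [norm_mul, mul_pow, mul_comm]
          gcongr
          exact hb j
      _ = A ^ 2 * ∑ j, ‖inner ℂ x (expVec (ξ j) (N + 1))‖ ^ 2 := by rw [Finset.mul_sum]
      _ ≤ A ^ 2 * ((((N + 1 : ℕ) : ℝ) + C) * ‖x‖ ^ 2) := by gcongr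
      _ = _ := by push_cast; ring
  rw [hg, orbitSum_add, orbitSum_add, orbitSum_add, orbitSum_sum, orbitSum_sum,
    Finset.sum_eq_zero fun k _ => h0 k, zero_add]
  -- The small vector `t` and the negligible vector `h` each cost one `ε`, which gives the factor `2
  -- * ε`.
  have h2 : ‖orbitSum V t x‖ ≤ ε * √(N + 1 : ℝ) * ‖x‖ :=
    (norm_orbitSum_le t N x).trans (by gcongr)
  have h3 := hNh x
  calc _ ≤ ‖∑ j, orbitSum V (b j • v j) x‖ + ‖orbitSum V t x‖ + ‖orbitSum V h x‖ :=
        norm_add₃_le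
    _ ≤ _ := by linarith

end Orbit

/-! ### Asymptotics of the eigenvalues -/

section Asymptotics

variable {E : Type*} [NormedAddCommGroup E] [InnerProductSpace ℂ E] {V : E →ₗᵢ[ℂ] E}

theorem tendsto_sqrt_add_mul_sq_div (A ε C : ℝ) :
    Tendsto (fun N : ℕ => (A * √(N + 1 + C) + 2 * ε * √(N + 1 : ℝ)) ^ 2 / (N : ℝ)) atTop
      (𝓝 ((A + 2 * ε) ^ 2)) := by
  have hinv : ∀ c : ℝ, Tendsto (fun N : ℕ => √(((N : ℝ) + c) / N)) atTop (𝓝 1) := by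
    intro c
    have h1 : Tendsto (fun N : ℕ => 1 + c / (N : ℝ)) atTop (𝓝 1) := by
      simpa using (tendsto_const_div_atTop_nhds_zero_nat c).const_add 1
    have h2 := (Real.continuous_sqrt.tendsto 1).comp h1
    rw [Real.sqrt_one] at h2
    refine h2.congr' ?_
    filter_upwards [eventually_gt_atTop 0] with N hN
    have hN' : (N : ℝ) ≠ 0 := by exact_mod_cast hN.ne'
    rw [Function.comp_apply]
    congr 1
    field_simp
  have h := (((hinv (1 + C)).const_mul A).add ((hinv 1).const_mul (2 * ε))).pow 2
  rw [mul_one, mul_one] at h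
  refine h.congr fun N => ?_
  have hN : (0 : ℝ) ≤ N := Nat.cast_nonneg N
  rw [Real.sqrt_div' _ hN, Real.sqrt_div' _ hN, ← mul_div_assoc, ← mul_div_assoc, ← add_div,
    div_pow, Real.sq_sqrt hN, add_assoc]

theorem SpectralDecomposition.isNegligible [CompleteSpace E] {g : E}
    (D : SpectralDecomposition V g) : IsNegligible V (D.gsc + D.gac + D.gnu) :=
  ((isNegligible_of_mem_singularContinuousPart D.gsc_mem).add
    (isNegligible_of_mem_absolutelyContinuousPart D.gac_mem)).add
    (isNegligible_of_mem_nonUnitaryPart D.gnu_mem)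

/-- Negligible vectors are orthogonal to eigenvectors, so the coefficients of any decomposition are
forced. -/
theorem SpectralDecomposition.inner_v [CompleteSpace E] {g : E} (D : SpectralDecomposition V g)
    {i : ℕ} (hi : (i : ℕ∞) < D.n) : inner ℂ (D.v i) g = D.a i := by
  obtain ⟨ξ, hξ⟩ := D.eigenvector i hi
  have h0 := D.isNegligible.inner_eigenvector hξ
  have h1 : g - D.gsc - D.gac - D.gnu = g - (D.gsc + D.gac + D.gnu) := by abel
  have h2 : HasSum (fun j => inner ℂ (D.v i) (D.a j • D.v j)) (inner ℂ (D.v i) g) := by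
    have := (innerSL ℂ (D.v i)).hasSum D.hasSum
    rw [h1, map_sub, innerSL_apply_apply, innerSL_apply_apply, h0, sub_zero] at this
    exact this
  refine h2.unique ?_
  have h3 : inner ℂ (D.v i) (D.a i • D.v i) = D.a i := by
    rw [inner_smul_right, inner_self_eq_norm_sq_to_K, D.orthonormal.1 ⟨i, hi⟩]
    simp
  rw [← h3]
  refine hasSum_single i fun j hj => ?_
  rcases lt_or_ge (j : ℕ∞) D.n with hjn | hjn
  · rw [inner_smul_right, D.orthonormal.2 (i := ⟨i, hi⟩) (j := ⟨j, hjn⟩)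
      (fun h => hj (congrArg Subtype.val h).symm), mul_zero]
  · rw [D.coeff_eq_zero j hjn, zero_smul, inner_zero_right]

/-- Eigenvalues of distinct members of the list are distinct, because the list is complete. -/
theorem SpectralDecomposition.eq_of_eigenvalue_eq {g : E} (D : SpectralDecomposition V g)
    {i j : ℕ} (hi : (i : ℕ∞) < D.n) (hj : (j : ℕ∞) < D.n) {ξ : ℂ} (hVi : V (D.v i) = ξ • D.v i)
    (hVj : V (D.v j) = ξ • D.v j) : i = j := by
  by_contra hij
  have hort : ∀ {k l : ℕ} (hk : (k : ℕ∞) < D.n) (hl : (l : ℕ∞) < D.n), k ≠ l →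
      inner ℂ (D.v k) (D.v l) = 0 := fun hk hl hkl =>
    D.orthonormal.2 (i := ⟨_, hk⟩) (j := ⟨_, hl⟩) fun h => hkl (congrArg Subtype.val h)
  have hone : ∀ {k : ℕ} (hk : (k : ℕ∞) < D.n), inner ℂ (D.v k) (D.v k) = 1 := fun hk => by
    rw [inner_self_eq_norm_sq_to_K, D.orthonormal.1 ⟨_, hk⟩]
    simp
  have hi1 : inner ℂ (D.v i) (D.v i + D.v j) = 1 := by
    rw [inner_add_right, hone hi, hort hi hj hij, add_zero]
  have hj1 : inner ℂ (D.v j) (D.v i + D.v j) = 1 := by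
    rw [inner_add_right, hone hj, hort hj hi (Ne.symm hij), zero_add]
  -- The sum would be an eigenvector with nonzero components along two members, hence a multiple of
  -- no single one.
  obtain ⟨m, hm, c, hc⟩ := D.complete (D.v i + D.v j)
    (fun h => by rw [h, inner_zero_right] at hi1; exact zero_ne_one hi1)
    ⟨ξ, by rw [map_add, hVi, hVj, smul_add]⟩
  rw [hc, inner_smul_right] at hi1 hj1
  have h1 : i = m := by
    by_contra h
    rw [hort hi hm h, mul_zero] at hi1
    exact zero_ne_one hi1
  have h2 : j = m := by
    by_contra h
    rw [hort hj hm h, mul_zero] at hj1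
    exact zero_ne_one hj1
  exact hij (h1.trans h2.symm)

/-- By monotonicity the coefficients up to `i` are at least `‖D.a i‖`, which gives the lower bound;
those from `i` on are at most `‖D.a i‖`, which gives the upper bound once the first `i` terms are
removed. -/
theorem SpectralDecomposition.tendsto_orbitGramEigenvalue [CompleteSpace E] {g : E}
    (D : SpectralDecomposition V g) (i : ℕ) :
    Tendsto (fun N : ℕ => orbitGramEigenvalue V g N i / (N : ℝ)) atTop (𝓝 (‖D.a i‖ ^ 2)) := by
  choose! ξ hξ using D.eigenvector
  have hinj : ∀ {j k : ℕ}, (j : ℕ∞) < D.n → (k : ℕ∞) < D.n → ξ j = ξ k → j = k :=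
    fun hj hk h => D.eq_of_eigenvalue_eq hj hk (hξ _ hj) (by rw [h]; exact hξ _ hk)
  rw [tendsto_order]
  constructor
  · intro y hy
    -- Covers the indices `i ≥ D.n`, where no eigenvector is available; nonnegativity of the
    -- eigenvalues suffices.
    by_cases hai : D.a i = 0
    · refine Eventually.of_forall fun N => hy.trans_le ?_
      rw [hai, norm_zero, zero_pow two_ne_zero]
      exact div_nonneg (orbitGramEigenvalue_nonneg g N i) (Nat.cast_nonneg N)
    have hin : (i : ℕ∞) < D.n := by
      by_contra h
      exact hai (D.coeff_eq_zero i (not_lt.1 h))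
    have hlt : ∀ j : Fin (i + 1), ((j : ℕ) : ℕ∞) < D.n := fun j =>
      lt_of_le_of_lt (by exact_mod_cast Nat.lt_succ_iff.1 j.2) hin
    obtain ⟨C, hC⟩ := exists_le_orbitGramEigenvalue (V := V) (i := i) (v := fun j => D.v j)
      (ξ := fun j => ξ j) (g := g) (α := ‖D.a i‖ ^ 2)
      (D.orthonormal.comp (fun j : Fin (i + 1) => ⟨(j : ℕ), hlt j⟩) fun j k h =>
        Fin.ext (congrArg Subtype.val h))
      (fun j => hξ j (hlt j)) (fun j k h => Fin.ext (hinj (hlt j) (hlt k) h)) (by positivity)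
      fun j => by
        rw [D.inner_v (hlt j)]
        exact pow_le_pow_left₀ (norm_nonneg _) (D.coeff_antitone (Nat.lt_succ_iff.1 j.2)) 2
    have hlim : Tendsto (fun N : ℕ => ‖D.a i‖ ^ 2 * (N + 1 - C) / (N : ℝ)) atTop
        (𝓝 (‖D.a i‖ ^ 2)) := by
      have h1 : Tendsto (fun N : ℕ => ‖D.a i‖ ^ 2 * (1 + (1 - C) / (N : ℝ))) atTop
          (𝓝 (‖D.a i‖ ^ 2)) := by
        simpa using ((tendsto_const_div_atTop_nhds_zero_nat (1 - C)).const_add 1).const_mul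
          (‖D.a i‖ ^ 2)
      refine h1.congr' ?_
      filter_upwards [eventually_gt_atTop 0] with N hN
      have hN' : (N : ℝ) ≠ 0 := by exact_mod_cast hN.ne'
      field_simp
      ring
    filter_upwards [hC, hlim.eventually (lt_mem_nhds hy)] with N h1 h2
    exact h2.trans_le (div_le_div_of_nonneg_right h1 (Nat.cast_nonneg N))
  · intro y hy
    obtain ⟨ε, hε, hεy⟩ : ∃ ε > 0, (‖D.a i‖ + 2 * ε) ^ 2 < y := by
      have hcont : Tendsto (fun ε : ℝ => (‖D.a i‖ + 2 * ε) ^ 2) (𝓝[>] 0) (𝓝 (‖D.a i‖ ^ 2)) := by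
        have : Continuous fun ε : ℝ => (‖D.a i‖ + 2 * ε) ^ 2 := by fun_prop
        simpa using (this.tendsto 0).mono_left nhdsWithin_le_nhds
      obtain ⟨ε, h1, h2⟩ := ((hcont.eventually (gt_mem_nhds hy)).and
        self_mem_nhdsWithin).exists
      exact ⟨ε, h2, h1⟩
    set S := g - D.gsc - D.gac - D.gnu with hS
    have htail : Tendsto (fun m => ‖S - ∑ j ∈ Finset.range m, D.a j • D.v j‖) atTop (𝓝 0) := by
      have := (D.hasSum.tendsto_sum_nat.const_sub S).norm
      rwa [← hS, sub_self, norm_zero] at this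
    obtain ⟨m, hm, him⟩ := ((htail.eventually (gt_mem_nhds hε)).and (eventually_ge_atTop i)).exists
    classical
    -- The filter keeps the family orthonormal, and the discarded terms vanish.
    let J : Finset ℕ := (Finset.Ico i m).filter fun j => (j : ℕ∞) < D.n
    have hJ : ∀ j : J, i ≤ (j : ℕ) ∧ ((j : ℕ) : ℕ∞) < D.n := fun j => by
      have := Finset.mem_filter.1 j.2
      exact ⟨(Finset.mem_Ico.1 this.1).1, this.2⟩
    have hsum : ∑ j ∈ Finset.range m, D.a j • D.v j =
        ∑ k : Fin i, D.a k • D.v k + ∑ j : J, D.a j • D.v j := by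
      rw [Fin.sum_univ_eq_sum_range (fun k => D.a k • D.v k),
        Finset.sum_coe_sort J (fun j => D.a j • D.v j), Finset.sum_filter_of_ne,
        Finset.sum_range_add_sum_Ico _ him]
      intro j _ hj
      by_contra h
      exact hj (by rw [D.coeff_eq_zero j (not_lt.1 h), zero_smul])
    -- For `k ≥ D.n` the term `D.a k • D.v k` is zero, so the default value of `ξ k` is harmless.
    obtain ⟨C, hC0, hC⟩ := exists_orbitGramEigenvalue_le (V := V) (i := i)
      (u := fun k => D.a k • D.v k) (κ := fun k => ξ k) (fun k => by
        rcases lt_or_ge ((k : ℕ) : ℕ∞) D.n with hk | hk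
        · rw [map_smul, hξ _ hk, smul_comm]
        · simp [D.coeff_eq_zero _ hk])
      (ι := J) (v := fun j => D.v j) (ξ := fun j => ξ j)
      (D.orthonormal.comp (fun j : J => ⟨(j : ℕ), (hJ j).2⟩) fun j k h =>
        Subtype.ext (Subtype.mk.inj h))
      (fun j => hξ _ (hJ j).2) (fun j k h => Subtype.ext (hinj (hJ j).2 (hJ k).2 h))
      (b := fun j => D.a j) (A := ‖D.a i‖) (norm_nonneg _)
      (fun j => D.coeff_antitone (hJ j).1) (g := g)
      (t := S - ∑ j ∈ Finset.range m, D.a j • D.v j) D.isNegligible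
      (by rw [← hsum, hS]; abel) hε hm.le
    filter_upwards [hC, (tendsto_sqrt_add_mul_sq_div ‖D.a i‖ ε C).eventually (gt_mem_nhds hεy)]
      with N h1 h2
    exact (div_le_div_of_nonneg_right h1 (Nat.cast_nonneg N)).trans_lt h2

end Asymptotics

/-! ### The Gram matrices of the time series -/

section Series

variable {f : ℕ → ℂ} {hf : HasAutocovariances f}

/-- The shifted series `F_l` as an element of the span. -/
def preShifted (f : ℕ → ℂ) (hf : HasAutocovariances f) (l : ℕ) : PreSpace f hf :=
  ⟨fun k => f (k + l), Submodule.subset_span ⟨l, rfl⟩⟩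

theorem timeShift_coe (x : PreSpace f hf) :
    timeShift f hf (x : HSpace f hf) = (preShift f hf x : HSpace f hf) :=
  ContinuousLinearMap.completion_apply_coe _ x

theorem timeShift_pow_obs (l : ℕ) :
    (timeShift f hf ^ l) (obs f hf) = (preShifted f hf l : HSpace f hf) := by
  induction l with
  | zero => rfl
  | succ l ih =>
    rw [pow_isometry_succ_apply, ih, timeShift_coe]
    congr 1
    apply Subtype.ext
    funext k
    show f (k + 1 + l) = f (k + (l + 1))
    congr 1
    omega

theorem inner_timeShift_pow_obs (i j : ℕ) :
    inner ℂ ((timeShift f hf ^ j) (obs f hf)) ((timeShift f hf ^ i) (obs f hf)) =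
      avgInner (preShifted f hf i) (preShifted f hf j) := by
  rw [timeShift_pow_obs, timeShift_pow_obs, UniformSpace.Completion.inner_coe]
  rfl

theorem tendsto_gramMatrix (N : ℕ) (i j : Fin (N + 1)) :
    Tendsto (fun M => gramMatrix f N M i j) atTop
      (𝓝 (orbitGram (timeShift f hf) (obs f hf) N i j)) := by
  have h0 : orbitGram (timeShift f hf) (obs f hf) N i j =
      avgInner (preShifted f hf i) (preShifted f hf j) := inner_timeShift_pow_obs _ _
  rw [h0]
  -- The Gram entries have `M + 1` terms but are divided by `M`; the factor `1 + 1 / M` corrects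
  -- this.
  have h1 : Tendsto (fun M : ℕ => 1 + (1 : ℂ) / (M : ℂ)) atTop (𝓝 1) := by
    simpa using (tendsto_one_div_atTop_nhds_zero_nat (𝕜 := ℂ)).const_add (1 : ℂ)
  have h2 := h1.mul ((tendsto_add_atTop_iff_nat 1).2
    (avgInner_spec (preShifted f hf i) (preShifted f hf j)))
  rw [one_mul] at h2
  refine h2.congr' ?_
  filter_upwards [eventually_gt_atTop 0] with M hM
  have hM' : (M : ℂ) ≠ 0 := by exact_mod_cast hM.ne'
  have hM1 : (M : ℂ) + 1 ≠ 0 := by exact_mod_cast M.succ_ne_zero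
  have hseq : ∀ l, (preShifted f hf l).seq = fun k => f (k + l) := fun _ => rfl
  simp only [timeAverage, hseq, gramMatrix, Matrix.of_apply, add_comm (i : ℕ), add_comm (j : ℕ)]
  push_cast
  field_simp

theorem tendsto_gramEigenvalue (hf : HasAutocovariances f) (N i : ℕ) :
    Tendsto (fun M => gramEigenvalue f N M i) atTop
      (𝓝 (orbitGramEigenvalue (timeShift f hf) (obs f hf) N i)) := by
  unfold gramEigenvalue orbitGramEigenvalue
  split_ifs with h
  · exact tendsto_eigenvalues₀ _ _ (tendsto_gramMatrix N) _
  · exact tendsto_const_nhds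

end Series

/-! ### The spectral measure of a unitary operator at a vector -/

section Spectral

variable {H : Type*} [NormedAddCommGroup H] [InnerProductSpace ℂ H] [CompleteSpace H]

/-- The identity function of the circle. -/
def circleCoe : C(Circle, ℂ) := ⟨fun z => (z : ℂ), by fun_prop⟩

/-- The continuous functional calculus of a unitary operator on functions on the circle. -/
theorem exists_circle_functionalCalculus {u : H →L[ℂ] H} (hu : u ∈ unitary (H →L[ℂ] H)) :
    ∃ Φ : C(Circle, ℂ) →⋆ₐ[ℂ] (H →L[ℂ] H), Φ circleCoe = u := by
  have hn : IsStarNormal u := Unitary.coe_isStarNormal ⟨u, hu⟩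
  -- Restricting functions to the spectrum puts the calculus, and later the measure, on the whole
  -- circle.
  let incl : C(spectrum ℂ u, Circle) :=
    ⟨fun z => ⟨z, spectrum.subset_circle_of_unitary hu z.2⟩, by fun_prop⟩
  refine ⟨(cfcHom hn).comp (ContinuousMap.compStarAlgHom' ℂ ℂ incl), ?_⟩
  rw [StarAlgHom.comp_apply]
  conv_rhs => rw [← cfcHom_id (R := ℂ) hn]
  rfl

/-- Real-valued continuous functions as complex-valued ones. -/
def realToComplex : C(Circle, ℝ) →ₗ[ℝ] C(Circle, ℂ) where
  toFun φ := ⟨fun z => (φ z : ℂ), by fun_prop⟩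
  map_add' φ ψ := by ext z; simp
  map_smul' c φ := by ext z; simp

/-- This gives both the positivity of the functional `φ ↦ inner ℂ g (Φ φ g)` and the norm identity
for its measure. -/
theorem inner_apply_nonneg (Φ : C(Circle, ℂ) →⋆ₐ[ℂ] (H →L[ℂ] H)) (φ : C(Circle, ℂ)) (g : H) :
    inner ℂ g (Φ (star φ * φ) g) = ((‖Φ φ g‖ ^ 2 : ℝ) : ℂ) := by
  rw [map_mul, map_star, mul_apply_eq_comp, ContinuousLinearMap.star_eq_adjoint,
    ContinuousLinearMap.adjoint_inner_right, inner_self_eq_norm_sq_to_K]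
  push_cast
  rfl

/-- The spectral measure of the vector `g`, through the norms of `Φ φ g`. -/
theorem exists_measure_norm_sq (Φ : C(Circle, ℂ) →⋆ₐ[ℂ] (H →L[ℂ] H)) (g : H) :
    ∃ ν : Measure Circle, IsFiniteMeasure ν ∧
      ∀ φ : C(Circle, ℂ), ‖Φ φ g‖ ^ 2 = ∫ z, ‖φ z‖ ^ 2 ∂ν := by
  let Λ₀ : C(Circle, ℝ) →ₗ[ℝ] ℝ :=
    { toFun := fun φ => (inner ℂ g (Φ (realToComplex φ) g)).re
      map_add' := fun φ ψ => by simp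
      map_smul' := fun c φ => by
        have h : realToComplex (c • φ) = (c : ℂ) • realToComplex φ := by
          ext z
          simp [realToComplex]
        rw [h, map_smul, smul_apply, inner_smul_right, Complex.re_ofReal_mul]
        rfl }
  have hpos : ∀ φ : C(Circle, ℝ), 0 ≤ φ → 0 ≤ Λ₀ φ := by
    intro φ hφ
    let ψ : C(Circle, ℝ) := ⟨fun z => √(φ z), by fun_prop⟩
    have h1 : realToComplex φ = star (realToComplex ψ) * realToComplex ψ := by
      ext z
      simp only [realToComplex, LinearMap.coe_mk, AddHom.coe_mk, ContinuousMap.mul_apply,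
        ContinuousMap.star_apply, ContinuousMap.coe_mk, ψ, RCLike.star_def, Complex.conj_ofReal]
      rw [← Complex.ofReal_mul, Real.mul_self_sqrt (show 0 ≤ φ z from hφ z)]
    show 0 ≤ (inner ℂ g (Φ (realToComplex φ) g)).re
    rw [h1, inner_apply_nonneg, Complex.ofReal_re]
    positivity
  -- The circle is compact, so the Riesz–Markov–Kakutani theorem applies to all continuous
  -- functions.
  let Λ : CompactlySupportedContinuousMap Circle ℝ →ₚ[ℝ] ℝ := PositiveLinearMap.mk₀
    { toFun := fun φ => Λ₀ φ.toContinuousMap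
      map_add' := fun φ ψ => Λ₀.map_add _ _
      map_smul' := fun c φ => Λ₀.map_smul _ _ } (fun φ hφ => hpos _ hφ)
  refine ⟨RealRMK.rieszMeasure Λ, ?_, fun φ => ?_⟩
  · have : IsFiniteMeasureOnCompacts (RealRMK.rieszMeasure Λ) := inferInstance
    exact ⟨isCompact_univ.measure_lt_top⟩
  · let φ₂ : C(Circle, ℝ) := ⟨fun z => ‖φ z‖ ^ 2, by fun_prop⟩
    have h1 : realToComplex φ₂ = star φ * φ := by
      ext z
      simp only [realToComplex, LinearMap.coe_mk, AddHom.coe_mk, ContinuousMap.mul_apply,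
        ContinuousMap.star_apply, ContinuousMap.coe_mk, φ₂, RCLike.star_def]
      rw [Complex.conj_mul']
      push_cast
      rfl
    have h2 := RealRMK.integral_rieszMeasure Λ
      (CompactlySupportedContinuousMap.continuousMapEquiv φ₂)
    have h3 : Λ (CompactlySupportedContinuousMap.continuousMapEquiv φ₂) = ‖Φ φ g‖ ^ 2 := by
      show (inner ℂ g (Φ (realToComplex φ₂) g)).re = _
      rw [h1, inner_apply_nonneg, Complex.ofReal_re]
    rw [← h3, ← h2]
    rfl

theorem norm_toLp_sq {ν : Measure Circle} [IsFiniteMeasure ν] (φ : C(Circle, ℂ)) :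
    ‖ContinuousMap.toLp 2 ν ℂ φ‖ ^ 2 = ∫ z, ‖φ z‖ ^ 2 ∂ν := by
  have h1 : ((‖ContinuousMap.toLp 2 ν ℂ φ‖ ^ 2 : ℝ) : ℂ) = ((∫ z, ‖φ z‖ ^ 2 ∂ν : ℝ) : ℂ) := by
    have h := inner_self_eq_norm_sq_to_K (𝕜 := ℂ) (ContinuousMap.toLp 2 ν ℂ φ)
    rw [ContinuousMap.inner_toLp] at h
    push_cast
    refine h.symm.trans ?_
    rw [← integral_complex_ofReal]
    refine integral_congr_ae (Eventually.of_forall fun z => ?_)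
    simp [Complex.mul_conj']
  exact Complex.ofReal_injective h1

/-- Multiplication by the coordinate function on `L²`. -/
def mulCoord (ν : Measure Circle) [IsFiniteMeasure ν] : Lp ℂ 2 ν →L[ℂ] Lp ℂ 2 ν :=
  (ContinuousLinearMap.mul ℂ ℂ).holderL ν ⊤ 2 2 (ContinuousMap.toLp ⊤ ν ℂ circleCoe)

theorem coeFn_mulCoord {ν : Measure Circle} [IsFiniteMeasure ν] (ψ : Lp ℂ 2 ν) :
    mulCoord ν ψ =ᵐ[ν] fun z => (z : ℂ) * ψ z := by
  have h1 : mulCoord ν ψ =ᵐ[ν] fun z =>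
      (ContinuousLinearMap.mul ℂ ℂ) (ContinuousMap.toLp ⊤ ν ℂ circleCoe z) (ψ z) :=
    ContinuousLinearMap.coeFn_holder _ _ _
  filter_upwards [h1, ContinuousMap.coeFn_toLp (p := ⊤) (𝕜 := ℂ) ν circleCoe] with z hz hz'
  rw [hz, hz']
  rfl

theorem mulCoord_toLp {ν : Measure Circle} [IsFiniteMeasure ν] (φ : C(Circle, ℂ)) :
    mulCoord ν (ContinuousMap.toLp 2 ν ℂ φ) = ContinuousMap.toLp 2 ν ℂ (circleCoe * φ) := by
  apply Lp.ext
  filter_upwards [coeFn_mulCoord (ContinuousMap.toLp 2 ν ℂ φ),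
    ContinuousMap.coeFn_toLp (p := 2) (𝕜 := ℂ) ν φ,
    ContinuousMap.coeFn_toLp (p := 2) (𝕜 := ℂ) ν (circleCoe * φ)] with z h1 h2 h3
  rw [h1, h2, h3]
  rfl

/-- The **spectral theorem** for the cyclic subspace of a vector `g` under a unitary operator: it
is an isometric image of `L²` of a finite measure on the circle, on which the operator acts as the
multiplication by the coordinate and `g` corresponds to the constant `1`. -/
theorem exists_spectral_model {u : H →L[ℂ] H} (hu : u ∈ unitary (H →L[ℂ] H)) (g : H) :
    ∃ (ν : Measure Circle) (_ : IsFiniteMeasure ν) (W : Lp ℂ 2 ν →ₗᵢ[ℂ] H),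
      W (ContinuousMap.toLp 2 ν ℂ 1) = g ∧ ∀ ψ, u (W ψ) = W (mulCoord ν ψ) := by
  obtain ⟨Φ, hΦ⟩ := exists_circle_functionalCalculus hu
  obtain ⟨ν, hν, hnorm⟩ := exists_measure_norm_sq Φ g
  refine ⟨ν, hν, ?_⟩
  -- This map is isometric for the `L²(ν)` seminorm, hence extends from the dense image of the
  -- continuous functions.
  let F : C(Circle, ℂ) →ₗ[ℂ] H :=
    { toFun := fun φ => Φ φ g
      map_add' := fun φ ψ => by simp
      map_smul' := fun c φ => by simp }
  let e : C(Circle, ℂ) →ₗ[ℂ] Lp ℂ 2 ν := (ContinuousMap.toLp 2 ν ℂ).toLinearMap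
  have hd : DenseRange e := ContinuousMap.toLp_denseRange ℂ ν ℂ (by norm_num)
  have hFe : ∀ φ, ‖F φ‖ = ‖e φ‖ := fun φ => by
    have : ‖F φ‖ ^ 2 = ‖e φ‖ ^ 2 := (hnorm φ).trans (norm_toLp_sq φ).symm
    exact (sq_eq_sq₀ (norm_nonneg _) (norm_nonneg _)).1 this
  have hext : ∀ φ, F.extendOfNorm e (e φ) = F φ :=
    LinearMap.extendOfNorm_eq hd ⟨1, fun φ => by rw [one_mul, hFe]⟩
  let W : Lp ℂ 2 ν →ₗᵢ[ℂ] H := ⟨(F.extendOfNorm e).toLinearMap, fun ψ => by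
    refine hd.induction_on (p := fun ψ => ‖F.extendOfNorm e ψ‖ = ‖ψ‖) ψ
      (isClosed_eq (F.extendOfNorm e).continuous.norm continuous_norm) fun φ => ?_
    rw [hext, hFe]⟩
  have hW : ∀ φ, W (e φ) = Φ φ g := hext
  refine ⟨W, ?_, fun ψ => ?_⟩
  · refine (hW 1).trans ?_
    rw [map_one]
    rfl
  · refine hd.induction_on (p := fun ψ => u (W ψ) = W (mulCoord ν ψ)) ψ
      (isClosed_eq (u.continuous.comp W.continuous)
        (W.continuous.comp (mulCoord ν).continuous)) fun φ => ?_
    have h1 : mulCoord ν (e φ) = e (circleCoe * φ) := mulCoord_toLp φ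
    rw [h1, hW, hW, map_mul, hΦ]
    rfl

end Spectral

/-! ### Splitting a vector according to its spectral measure -/

section Splitting

variable {H : Type*} [NormedAddCommGroup H] [InnerProductSpace ℂ H]
  {ν : Measure Circle} [IsFiniteMeasure ν]

/-- The indicator function of a set as an element of `L²`. -/
def indL2 (ν : Measure Circle) [IsFiniteMeasure ν] (B : Set Circle) (hB : MeasurableSet B) :
    Lp ℂ 2 ν :=
  indicatorConstLp 2 hB (measure_ne_top ν B) (1 : ℂ)

theorem coeFn_indL2 {B : Set Circle} (hB : MeasurableSet B) :
    indL2 ν B hB =ᵐ[ν] B.indicator fun _ => (1 : ℂ) :=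
  indicatorConstLp_coeFn

theorem indL2_univ : indL2 ν Set.univ MeasurableSet.univ = ContinuousMap.toLp 2 ν ℂ 1 := by
  apply Lp.ext
  filter_upwards [coeFn_indL2 (ν := ν) MeasurableSet.univ,
    ContinuousMap.coeFn_toLp (p := 2) (𝕜 := ℂ) ν (1 : C(Circle, ℂ))] with z h1 h2
  rw [h1, h2]
  simp

theorem indL2_union {A B : Set Circle} (hA : MeasurableSet A) (hB : MeasurableSet B)
    (hAB : Disjoint A B) : indL2 ν (A ∪ B) (hA.union hB) = indL2 ν A hA + indL2 ν B hB :=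
  indicatorConstLp_disjoint_union hA hB (measure_ne_top ν A) (measure_ne_top ν B) hAB 1

theorem coeFn_mulCoord_pow (ψ : Lp ℂ 2 ν) (k : ℕ) :
    (mulCoord ν ^ k) ψ =ᵐ[ν] fun z => (z : ℂ) ^ k * ψ z := by
  induction k with
  | zero => simp
  | succ k ih =>
    rw [pow_succ', mul_apply_eq_comp]
    filter_upwards [coeFn_mulCoord ((mulCoord ν ^ k) ψ), ih] with z h1 h2
    rw [h1, h2, pow_succ']
    ring

theorem mulCoord_indL2_singleton (w : Circle) :
    mulCoord ν (indL2 ν {w} (measurableSet_singleton w)) =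
      (w : ℂ) • indL2 ν {w} (measurableSet_singleton w) := by
  apply Lp.ext
  filter_upwards [coeFn_mulCoord (indL2 ν {w} (measurableSet_singleton w)),
    Lp.coeFn_smul (w : ℂ) (indL2 ν {w} (measurableSet_singleton w)),
    coeFn_indL2 (ν := ν) (measurableSet_singleton w)] with z h1 h2 h3
  rw [h1, h2, Pi.smul_apply, h3, smul_eq_mul]
  by_cases hz : z = w
  · rw [hz]
  · simp [hz]

variable {u : H →L[ℂ] H} {W : Lp ℂ 2 ν →ₗᵢ[ℂ] H}

theorem pow_apply_spectral_model (hW : ∀ ψ, u (W ψ) = W (mulCoord ν ψ)) (ψ : Lp ℂ 2 ν) (k : ℕ) :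
    (u ^ k) (W ψ) = W ((mulCoord ν ^ k) ψ) := by
  induction k with
  | zero => simp
  | succ k ih => rw [pow_succ', pow_succ', mul_apply_eq_comp, ih, hW, mul_apply_eq_comp]

/-- Thus cutting the circle into Borel pieces cuts the vector into pieces with the restricted
spectral measures. -/
theorem integral_pow_restrict (hW : ∀ ψ, u (W ψ) = W (mulCoord ν ψ)) {B : Set Circle}
    (hB : MeasurableSet B) (k : ℕ) :
    ∫ z : Circle, (z : ℂ) ^ k ∂(ν.restrict B) =
      inner ℂ (W (indL2 ν B hB)) ((u ^ k) (W (indL2 ν B hB))) := by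
  rw [pow_apply_spectral_model hW, W.inner_map_map, indL2, L2.inner_indicatorConstLp_one]
  refine (setIntegral_congr_ae hB ?_).symm
  filter_upwards [coeFn_mulCoord_pow (indL2 ν B hB) k, coeFn_indL2 (ν := ν) hB] with z h1 h2 hz
  rw [indL2] at h1 h2
  rw [h1, h2]
  simp [hz]

theorem indL2_empty : indL2 ν ∅ MeasurableSet.empty = 0 :=
  indicatorConstLp_empty

theorem spectral_model_finset_mem (hW : ∀ ψ, u (W ψ) = W (mulCoord ν ψ)) (s : Finset Circle) :
    W (indL2 ν s s.measurableSet) ∈ Submodule.span ℂ {w : H | ∃ ξ : ℂ, u w = ξ • w} := by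
  classical
  induction s using Finset.induction_on with
  | empty =>
    have : indL2 ν ((∅ : Finset Circle) : Set Circle) (Finset.measurableSet ∅) = 0 := by
      simp only [Finset.coe_empty]
      exact indL2_empty
    rw [this, map_zero]
    exact zero_mem _
  | insert w s hw ih =>
    have h : indL2 ν ((insert w s : Finset Circle) : Set Circle) (Finset.measurableSet _) =
        indL2 ν {w} (measurableSet_singleton w) + indL2 ν s s.measurableSet := by
      rw [← indL2_union _ _ (by simpa using hw)]
      simp only [Finset.coe_insert]
      rfl
    rw [h, map_add]
    refine add_mem (Submodule.subset_span ⟨w, ?_⟩) ih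
    rw [hW, mulCoord_indL2_singleton, map_smul]

/-- The part of the vector that belongs to countably many atoms lies in the closed span of the
eigenvectors. -/
theorem spectral_model_countable_mem (hW : ∀ ψ, u (W ψ) = W (mulCoord ν ψ)) {A : Set Circle}
    (hA : A.Countable) : W (indL2 ν A hA.measurableSet) ∈
      (Submodule.span ℂ {w : H | ∃ ξ : ℂ, u w = ξ • w}).topologicalClosure := by
  classical
  rcases A.eq_empty_or_nonempty with rfl | hne
  · have : indL2 ν ∅ hA.measurableSet = 0 := indL2_empty
    rw [this, map_zero]
    exact zero_mem _
  obtain ⟨a, rfl⟩ := hA.exists_eq_range hne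
  let s : ℕ → Finset Circle := fun n => (Finset.range n).image a
  have hs : Monotone fun n => (s n : Set Circle) := fun m n hmn => by
    exact_mod_cast Finset.image_subset_image (Finset.range_mono hmn)
  have hsU : ⋃ n, (s n : Set Circle) = Set.range a := by
    ext z
    simp only [Set.mem_iUnion, s, Finset.coe_image, Set.mem_image, Finset.coe_range, Set.mem_Iio,
      Set.mem_range]
    exact ⟨fun ⟨n, k, _, h⟩ => ⟨k, h⟩, fun ⟨k, h⟩ => ⟨k + 1, k, Nat.lt_succ_self k, h⟩⟩
  -- The finite sets exhaust the countable one, so the measure of the difference tends to zero.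
  have hlim : Tendsto (fun n => indL2 ν (s n) (s n).measurableSet) atTop
      (𝓝 (indL2 ν (Set.range a) hA.measurableSet)) := by
    refine tendsto_indicatorConstLp_set (by norm_num) ?_
    have hsub : ∀ n, (s n : Set Circle) ⊆ Set.range a := fun n => hsU ▸ Set.subset_iUnion (fun n => (s n : Set Circle)) n
    have h1 : ∀ n, ν (symmDiff (s n : Set Circle) (Set.range a)) = ν (Set.range a \ s n) := by
      intro n
      rw [Set.symmDiff_def, Set.sdiff_eq_empty.2 (hsub n), Set.empty_union]
    simp only [h1]
    have h2 : ⋂ n, (Set.range a \ (s n : Set Circle)) = ∅ := by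
      rw [← Set.sdiff_iUnion, hsU, Set.sdiff_self]
    have h3 := tendsto_measure_iInter_atTop (μ := ν)
      (s := fun n => Set.range a \ (s n : Set Circle))
      (fun n => (hA.measurableSet.diff (s n).measurableSet).nullMeasurableSet)
      (fun m n hmn => Set.sdiff_subset_sdiff_right (hs hmn)) ⟨0, measure_ne_top _ _⟩
    rwa [h2, measure_empty] at h3
  exact mem_closure_of_tendsto ((W.continuous.tendsto _).comp hlim)
    (Eventually.of_forall fun n => spectral_model_finset_mem hW (s n))

/-- Decomposition of a vector into a pure point, a singular continuous and an absolutely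
continuous part with respect to a unitary operator. -/
theorem exists_spectral_splitting [CompleteSpace H] (hu : u ∈ unitary (H →L[ℂ] H)) (g : H) :
    ∃ gpp gsc gac : H, g = gpp + gsc + gac ∧
      gpp ∈ (Submodule.span ℂ {w : H | ∃ ξ : ℂ, u w = ξ • w}).topologicalClosure ∧
      (∃ ν : Measure Circle, IsFiniteMeasure ν ∧
        (∀ k : ℕ, ∫ z : Circle, (z : ℂ) ^ k ∂ν = inner ℂ gsc ((u ^ k) gsc)) ∧
        (∀ z : Circle, ν {z} = 0) ∧ ν ⟂ₘ arcLength) ∧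
      (∃ ν : Measure Circle, IsFiniteMeasure ν ∧
        (∀ k : ℕ, ∫ z : Circle, (z : ℂ) ^ k ∂ν = inner ℂ gac ((u ^ k) gac)) ∧
        ν ≪ arcLength) := by
  obtain ⟨ν, hν, W, hWg, hW⟩ := exists_spectral_model hu g
  let A : Set Circle := {z | 0 < ν {z}}
  have hA : A.Countable := Measure.countable_meas_pos_of_disjoint_iUnion
    (fun z => measurableSet_singleton z) fun z w h => by simpa using h
  have : IsFiniteMeasure arcLength := by
    unfold arcLength
    have : IsFiniteMeasure (volume.restrict (Set.Ioc (-Real.pi) Real.pi)) :=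
      ⟨by simp [Real.volume_Ioc]⟩
    infer_instance
  -- The singular part of `ν` vanishes on `S`, and `Sᶜ` is Lebesgue-null. The pieces are the atoms
  -- `A`, then `Sᶜ \ A` and `S \ A`.
  obtain ⟨S, hS, hS0, hS1⟩ := ν.mutuallySingular_singularPart arcLength
  have hcompl : ν.restrict S ≪ arcLength := by
    rw [ν.haveLebesgueDecomposition_add arcLength, Measure.restrict_add,
      Measure.restrict_eq_zero.2 hS0, zero_add]
    exact Measure.restrict_le_self.absolutelyContinuous.trans
      (withDensity_absolutelyContinuous _ _)
  have hmA := hA.measurableSet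
  have hm1 : MeasurableSet (Sᶜ \ A) := hS.compl.diff hmA
  have hm2 : MeasurableSet (S \ A) := hS.diff hmA
  refine ⟨W (indL2 ν A hmA), W (indL2 ν (Sᶜ \ A) hm1), W (indL2 ν (S \ A) hm2), ?_,
    spectral_model_countable_mem hW hA, ⟨ν.restrict (Sᶜ \ A), inferInstance,
      integral_pow_restrict hW hm1, fun z => ?_, ?_⟩,
    ⟨ν.restrict (S \ A), inferInstance, integral_pow_restrict hW hm2, ?_⟩⟩
  · rw [← map_add, ← map_add, ← indL2_union hmA hm1 Set.disjoint_sdiff_right,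
      ← indL2_union (hmA.union hm1) hm2, ← hWg, ← indL2_univ]
    · congr 2
      ext z
      by_cases h1 : z ∈ A <;> by_cases h2 : z ∈ S <;> simp [h1, h2]
    · rw [Set.disjoint_left]
      rintro z (h | h) h'
      · exact h'.2 h
      · exact h.1 h'.1
  · rw [Measure.restrict_apply (measurableSet_singleton z)]
    by_cases hz : z ∈ A
    · have : {z} ∩ (Sᶜ \ A) = ∅ := by
        ext w
        simp only [Set.mem_inter_iff, Set.mem_singleton_iff, Set.mem_sdiff, Set.mem_empty_iff_false,
          iff_false]
        rintro ⟨rfl, -, h⟩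
        exact h hz
      rw [this, measure_empty]
    · refine measure_mono_null Set.inter_subset_left ?_
      simpa [A] using hz
  · refine ⟨S, hS, ?_, hS1⟩
    rw [Measure.restrict_apply hS]
    have : S ∩ (Sᶜ \ A) = ∅ := by
      ext w
      simp only [Set.mem_inter_iff, Set.mem_sdiff, Set.mem_compl_iff, Set.mem_empty_iff_false,
        iff_false]
      tauto
    rw [this, measure_empty]
  · exact (Measure.restrict_mono_set ν Set.sdiff_subset).absolutelyContinuous.trans hcompl

end Splitting

/-! ### Existence of the spectral decomposition -/

section UnitaryPart

variable {E : Type*} [NormedAddCommGroup E] [InnerProductSpace ℂ E] {V : E →ₗᵢ[ℂ] E}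

theorem mem_unitaryPart_iff {x : E} : x ∈ unitaryPart V ↔ ∀ k : ℕ, ∃ y, (V ^ k) y = x := by
  simp only [unitaryPart, Submodule.mem_iInf]
  rfl

theorem apply_mem_unitaryPart {x : E} (hx : x ∈ unitaryPart V) : V x ∈ unitaryPart V := by
  rw [mem_unitaryPart_iff] at hx ⊢
  intro k
  obtain ⟨y, rfl⟩ := hx k
  exact ⟨V y, by rw [← pow_isometry_succ_apply, pow_succ]; rfl⟩

/-- If `V y = x = (V ^ (k + 1)) z`, injectivity gives `y = (V ^ k) z`, so the preimage lies in every
range. -/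
theorem exists_apply_eq_of_mem_unitaryPart {x : E} (hx : x ∈ unitaryPart V) :
    ∃ y ∈ unitaryPart V, V y = x := by
  rw [mem_unitaryPart_iff] at hx
  obtain ⟨y, hy⟩ := hx 1
  rw [pow_one] at hy
  refine ⟨y, mem_unitaryPart_iff.2 fun k => ?_, hy⟩
  obtain ⟨z, hz⟩ := hx (k + 1)
  exact ⟨z, V.injective (by rw [← pow_isometry_succ_apply, hz, hy])⟩

theorem isClosed_unitaryPart [CompleteSpace E] : IsClosed (unitaryPart V : Set E) := by
  rw [unitaryPart, Submodule.coe_iInf]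
  exact isClosed_iInter fun k => (V ^ k).isometry.isClosedEmbedding.isClosed_range

/-- The isometry acts on its unitary part as a unitary operator. -/
theorem exists_unitary_restrict [CompleteSpace E] [CompleteSpace (unitaryPart V)] :
    ∃ u ∈ unitary (unitaryPart V →L[ℂ] unitaryPart V),
      ∀ (k : ℕ) (x : unitaryPart V), ((u ^ k) x : E) = (V ^ k) (x : E) := by
  let T : unitaryPart V →ₗᵢ[ℂ] unitaryPart V :=
    ⟨V.toLinearMap.restrict fun _ hx => apply_mem_unitaryPart hx, fun x => V.norm_map x⟩
  have hT : Function.Surjective T := fun x => by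
    obtain ⟨y, hy, hyx⟩ := exists_apply_eq_of_mem_unitaryPart x.2
    exact ⟨⟨y, hy⟩, Subtype.ext hyx⟩
  let e : unitaryPart V ≃ₗᵢ[ℂ] unitaryPart V := LinearIsometryEquiv.ofSurjective T hT
  refine ⟨(Unitary.linearIsometryEquiv.symm e : unitaryPart V →L[ℂ] unitaryPart V),
    (Unitary.linearIsometryEquiv.symm e).2, fun k x => ?_⟩
  induction k with
  | zero => simp
  | succ k ih =>
    rw [pow_succ', mul_apply_eq_comp, pow_isometry_succ_apply, ← ih]
    rfl

/-- Every vector is the sum of a vector in the closed span of the eigenvectors, and of a singular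
continuous, an absolutely continuous, and a completely non-unitary one. -/
theorem exists_splitting [CompleteSpace E] (V : E →ₗᵢ[ℂ] E) (g : E) :
    ∃ gpp gsc gac gnu : E, g = gpp + gsc + gac + gnu ∧
      gpp ∈ (Submodule.span ℂ {w : E | ∃ ξ : ℂ, V w = ξ • w}).topologicalClosure ∧
      gsc ∈ singularContinuousPart V ∧ gac ∈ absolutelyContinuousPart V ∧
      gnu ∈ nonUnitaryPart V := by
  have : CompleteSpace (unitaryPart V) := isClosed_unitaryPart.completeSpace_coe
  obtain ⟨u, hu, huV⟩ := exists_unitary_restrict (V := V)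
  obtain ⟨gpp, gsc, gac, hsum, hpp, ⟨ν, h1, h2, h3, h4⟩, ⟨μ, h5, h6, h7⟩⟩ :=
    exists_spectral_splitting hu ((unitaryPart V).orthogonalProjectionOnto g)
  have hinner : ∀ (x : unitaryPart V) (k : ℕ),
      inner ℂ x ((u ^ k) x) = inner ℂ (x : E) ((V ^ k) (x : E)) := fun x k => by
    rw [← huV]
    rfl
  refine ⟨gpp, gsc, gac, g - (unitaryPart V).orthogonalProjectionOnto g, ?_, ?_,
    ⟨gsc.2, ν, ⟨h1, fun k => ?_⟩, h3, h4⟩, ⟨gac.2, μ, ⟨h5, fun k => ?_⟩, h7⟩, ?_⟩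
  · rw [hsum]
    push_cast
    abel
  · refine map_mem_closure continuous_subtype_val hpp fun x hx => ?_
    have hle : Submodule.span ℂ {w : unitaryPart V | ∃ ξ : ℂ, u w = ξ • w} ≤
        (Submodule.span ℂ {w : E | ∃ ξ : ℂ, V w = ξ • w}).comap (unitaryPart V).subtype := by
      rw [Submodule.span_le]
      rintro w ⟨ξ, hw⟩
      refine Submodule.subset_span ⟨ξ, ?_⟩
      have := huV 1 w
      rw [pow_one, pow_one, hw] at this
      exact this.symm
    exact hle hx
  · rw [h2, hinner]
  · rw [h6, hinner]
  · exact (unitaryPart V).sub_starProjection_mem_orthogonal g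

end UnitaryPart

/-- A family of positive numbers that tends to zero can be enumerated in nonincreasing order. -/
theorem exists_sorted_enumeration {ι : Type*} (c : ι → ℝ) (hpos : ∀ i, 0 < c i)
    (hfin : ∀ ε > 0, {i | ε ≤ c i}.Finite) :
    ∃ (n : ℕ∞) (e : {k : ℕ // (k : ℕ∞) < n} ≃ ι), ∀ k l, k ≤ l → c (e l) ≤ c (e k) := by
  classical
  -- Decreasing order of `c`, ties broken by a well-order: a strict total order with finitely many
  -- predecessors of each element, whose number is the rank.
  let lt : ι → ι → Prop := fun i j => c j < c i ∨ (c i = c j ∧ WellOrderingRel i j)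
  have hirr : ∀ i, ¬ lt i i := fun i h => by
    rcases h with h | ⟨-, h⟩
    · exact lt_irrefl _ h
    · exact irrefl_of WellOrderingRel i h
  have htrans : ∀ {i j k}, lt i j → lt j k → lt i k := by
    rintro i j k (h1 | ⟨h1, h1'⟩) (h2 | ⟨h2, h2'⟩)
    · exact Or.inl (h2.trans h1)
    · exact Or.inl (h2 ▸ h1)
    · exact Or.inl (h1 ▸ h2)
    · exact Or.inr ⟨h1.trans h2, trans_of WellOrderingRel h1' h2'⟩
  have htri : ∀ i j, lt i j ∨ i = j ∨ lt j i := by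
    intro i j
    rcases lt_trichotomy (c i) (c j) with h | h | h
    · exact Or.inr (Or.inr (Or.inl h))
    · rcases trichotomous_of WellOrderingRel i j with h' | h' | h'
      · exact Or.inl (Or.inr ⟨h, h'⟩)
      · exact Or.inr (Or.inl h')
      · exact Or.inr (Or.inr (Or.inr ⟨h.symm, h'⟩))
    · exact Or.inl (Or.inl h)
  have hpred : ∀ i, {j | lt j i}.Finite := fun i => (hfin (c i) (hpos i)).subset fun j hj => by
    rcases hj with h | ⟨h, -⟩
    · exact h.le
    · exact h.symm.le
  let rank : ι → ℕ := fun i => {j | lt j i}.ncard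
  have hmono : ∀ {i j}, lt i j → rank i < rank j := fun {i j} hij =>
    Set.ncard_lt_ncard ⟨fun k hk => htrans hk hij, fun h => hirr i (h hij)⟩ (hpred j)
  have hinj : Function.Injective rank := fun i j hij => by
    rcases htri i j with h | h | h
    · exact absurd hij (hmono h).ne
    · exact h
    · exact absurd hij (hmono h).ne'
  -- The ranks have no gaps: the last predecessor of `i` has rank one less.
  have hstep : ∀ i m, rank i = m + 1 → ∃ j, rank j = m := by
    intro i m him
    have hne : {j | lt j i}.Nonempty := by
      rw [← Set.ncard_pos (hpred i)]
      exact lt_of_lt_of_eq (Nat.succ_pos m) him.symm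
    obtain ⟨j, hj, hmax⟩ := Set.exists_max_image _ rank (hpred i) hne
    refine ⟨j, ?_⟩
    have hset : {k | lt k i} = insert j {k | lt k j} := by
      ext k
      simp only [Set.mem_ofPred_eq, Set.mem_insert_iff]
      constructor
      · intro hk
        rcases htri k j with h | h | h
        · exact Or.inr h
        · exact Or.inl h
        · exact absurd (hmax k hk) (not_le.2 (hmono h))
      · rintro (rfl | hk)
        · exact hj
        · exact htrans hk hj
    have hcard : rank i = rank j + 1 := by
      show {k | lt k i}.ncard = _
      rw [hset]
      exact Set.ncard_insert_of_notMem (s := {k | lt k j}) (hirr j) (hpred j)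
    omega
  have hdown : ∀ d m i, rank i = m + d → ∃ j, rank j = m := by
    intro d
    induction d with
    | zero => exact fun m i h => ⟨i, h⟩
    | succ d ih =>
      intro m i h
      obtain ⟨j, hj⟩ := hstep i (m + d) h
      exact ih m j hj
  -- The first value that is not a rank, or `⊤`.
  obtain ⟨n, hn⟩ : ∃ n : ℕ∞, ∀ k : ℕ, (k : ℕ∞) < n ↔ ∃ i, rank i = k := by
    by_cases hex : ∃ m, ¬ ∃ i, rank i = m
    · refine ⟨(Nat.find hex : ℕ), fun k => ?_⟩
      rw [Nat.cast_lt]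
      constructor
      · intro hk
        exact not_not.1 (Nat.find_min hex hk)
      · rintro ⟨i, hi⟩
        by_contra hk
        obtain ⟨d, hd⟩ := Nat.exists_eq_add_of_le (not_lt.1 hk)
        exact Nat.find_spec hex (hdown d _ i (hi.trans hd))
    · push Not at hex
      exact ⟨⊤, fun k => ⟨fun _ => hex k, fun _ => ENat.natCast_lt_top k⟩⟩
  let r : ι → {k : ℕ // (k : ℕ∞) < n} := fun i => ⟨rank i, (hn _).2 ⟨i, rfl⟩⟩
  have hr : Function.Bijective r :=
    ⟨fun i j h => hinj (congrArg Subtype.val h), fun ⟨k, hk⟩ => by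
      obtain ⟨i, hi⟩ := (hn k).1 hk
      exact ⟨i, Subtype.ext hi⟩⟩
  refine ⟨n, (Equiv.ofBijective r hr).symm, fun k l hkl => ?_⟩
  obtain ⟨i, rfl⟩ := hr.2 k
  obtain ⟨j, rfl⟩ := hr.2 l
  rw [Equiv.ofBijective_symm_apply_apply, Equiv.ofBijective_symm_apply_apply]
  by_contra h
  exact absurd (hmono (Or.inl (not_le.1 h))) (not_lt.2 hkl)

/-! ### The decomposition of a cyclic vector. -/

section Decomposition

variable {E : Type*} [NormedAddCommGroup E] [InnerProductSpace ℂ E] {V : E →ₗᵢ[ℂ] E}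

/-- Bessel's inequality makes the series converge; `x` minus its sum lies in the closed span and is
orthogonal to it. -/
theorem hasSum_inner_smul_of_mem_closure [CompleteSpace E] {ι : Type*} {v : ι → E}
    (hv : Orthonormal ℂ v) {x : E}
    (hx : x ∈ (Submodule.span ℂ (Set.range v)).topologicalClosure) :
    HasSum (fun i => inner ℂ (v i) x • v i) x := by
  have hsum : Summable fun i => inner ℂ (v i) x • v i := by
    have := (hv.orthogonalFamily.summable_iff_norm_sq_summable fun i => inner ℂ (v i) x).2
      (hv.inner_products_summable x)
    simpa using this
  obtain ⟨s, hs⟩ := hsum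
  have hs_mem : s ∈ (Submodule.span ℂ (Set.range v)).topologicalClosure := by
    refine mem_closure_of_tendsto hs (Eventually.of_forall fun t => ?_)
    exact Submodule.sum_mem _ fun i _ =>
      Submodule.smul_mem _ _ (Submodule.subset_span (Set.mem_range_self i))
  have hinner : ∀ j, inner ℂ (v j) (x - s) = 0 := by
    intro j
    have h1 : HasSum (fun i => inner ℂ (v j) (inner ℂ (v i) x • v i)) (inner ℂ (v j) s) :=
      (innerSL ℂ (v j)).hasSum hs
    have h2 : HasSum (fun i => inner ℂ (v j) (inner ℂ (v i) x • v i)) (inner ℂ (v j) x) := by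
      have h3 : inner ℂ (v j) (inner ℂ (v j) x • v j) = inner ℂ (v j) x := by
        rw [inner_smul_right, inner_self_eq_norm_sq_to_K, hv.1 j]
        simp
      rw [← h3]
      refine hasSum_single j fun i hi => ?_
      rw [inner_smul_right, hv.2 (Ne.symm hi), mul_zero]
    rw [inner_sub_right, h2.unique h1, sub_self]
  have horth : x - s ∈ (Submodule.span ℂ (Set.range v)).topologicalClosureᗮ := by
    rw [Submodule.orthogonal_closure, Submodule.mem_orthogonal]
    intro y hy
    induction hy using Submodule.span_induction with
    | mem y hy =>
      obtain ⟨j, rfl⟩ := hy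
      exact hinner j
    | zero => exact inner_zero_left _
    | add y z _ _ hy hz => rw [inner_add_left, hy, hz, add_zero]
    | smul c y _ hy => rw [inner_smul_left, hy, mul_zero]
  have hzero : x - s = 0 := by
    have := Submodule.inner_right_of_mem_orthogonal (sub_mem hx hs_mem) horth
    exact inner_self_eq_zero.1 this
  have hxs : s = x := (sub_eq_zero.1 hzero).symm
  rwa [hxs] at hs

theorem inner_eigenvectors_eq_zero {v w : E} {ξ η : ℂ} (hv : V v = ξ • v) (hw : V w = η • w)
    (hne : ξ ≠ η) : inner ℂ v w = 0 := by
  by_cases hv0 : v = 0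
  · simp [hv0]
  have h := inner_eigenvector_pow hv hv0 1 w
  rw [pow_one, pow_one, hw, inner_smul_right] at h
  have h2 : (η - ξ) * inner ℂ v w = 0 := by rw [sub_mul, h, sub_self]
  exact (mul_eq_zero.1 h2).resolve_left (sub_ne_zero.2 hne.symm)

/-- A cyclic vector of an isometry has a spectral decomposition. -/
theorem nonempty_spectralDecomposition [CompleteSpace E] {g : E}
    (hcyc : ∀ w : E, (∀ l : ℕ, inner ℂ w ((V ^ l) g) = 0) → w = 0) :
    Nonempty (SpectralDecomposition V g) := by
  classical
  -- An eigenvector orthogonal to `g` is orthogonal to its whole orbit.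
  have hzero : ∀ (w : E) (ξ : ℂ), V w = ξ • w → inner ℂ w g = 0 → w = 0 := fun w ξ hw h => by
    by_contra hw0
    exact hw0 (hcyc w fun l => by rw [inner_eigenvector_pow hw hw0, h, mul_zero])
  let ι : Type := {ξ : ℂ // ∃ w : E, w ≠ 0 ∧ V w = ξ • w}
  choose w hw0 hVw using fun ξ : ι => ξ.2
  let v : ι → E := fun ξ => ((‖w ξ‖⁻¹ : ℝ) : ℂ) • w ξ
  have hVv : ∀ ξ : ι, V (v ξ) = (ξ : ℂ) • v ξ := fun ξ => by
    simp only [v]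
    rw [map_smul, hVw, smul_comm]
  have hv1 : ∀ ξ, ‖v ξ‖ = 1 := fun ξ => by
    have := norm_ne_zero_iff.2 (hw0 ξ)
    simp only [v]
    rw [norm_smul, Complex.norm_real, norm_inv, norm_norm, inv_mul_cancel₀ this]
  have hv : Orthonormal ℂ v :=
    ⟨hv1, fun ξ η h => inner_eigenvectors_eq_zero (hVv ξ) (hVv η) fun h' => h (Subtype.ext h')⟩
  have hvg : ∀ ξ, inner ℂ (v ξ) g ≠ 0 := fun ξ h => by
    have := hzero (v ξ) ξ (hVv ξ) h
    exact hv.ne_zero ξ this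
  -- Eigenvalues are simple: `c` makes `x - c • v ξ` orthogonal to `g`, so this difference vanishes.
  -- Hence eigenvalues can index the eigenvectors.
  have hmul : ∀ (x : E) (ξ : ι), V x = (ξ : ℂ) • x → ∃ c : ℂ, x = c • v ξ := by
    intro x ξ hx
    have hβ : inner ℂ g (v ξ) ≠ 0 := fun h => hvg ξ (by rw [← inner_conj_symm, h, map_zero])
    refine ⟨inner ℂ g x / inner ℂ g (v ξ), sub_eq_zero.1 (hzero _ ξ ?_ ?_)⟩
    · rw [map_sub, map_smul, hx, hVv, smul_sub, smul_comm]
    · rw [← inner_conj_symm, inner_sub_right, inner_smul_right, div_mul_cancel₀ _ hβ, sub_self,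
        map_zero]
  -- The coefficients are nonzero and square summable, so only finitely many reach any given `ε >
  -- 0`.
  obtain ⟨n, e, he⟩ := exists_sorted_enumeration (fun ξ => ‖inner ℂ (v ξ) g‖)
    (fun ξ => norm_pos_iff.2 (hvg ξ)) fun ε hε => by
      have h1 := (hv.inner_products_summable g).tendsto_cofinite_zero
      have h2 : ∀ᶠ ξ in cofinite, ‖inner ℂ (v ξ) g‖ ^ 2 < ε ^ 2 :=
        h1.eventually (gt_mem_nhds (by positivity))
      refine (eventually_cofinite.1 h2).subset fun ξ hξ => ?_
      simp only [Set.mem_ofPred_eq, not_lt] at hξ ⊢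
      gcongr
  let v' : ℕ → E := fun k => if h : (k : ℕ∞) < n then v (e ⟨k, h⟩) else 0
  have hv'_lt : ∀ {k : ℕ} (h : (k : ℕ∞) < n), v' k = v (e ⟨k, h⟩) := fun h => dif_pos h
  have hv'_ge : ∀ {k : ℕ}, n ≤ (k : ℕ∞) → v' k = 0 := fun h => dif_neg (not_lt.2 h)
  obtain ⟨gpp, gsc, gac, gnu, hg, hpp, hsc, hac, hnu⟩ := exists_splitting V g
  have hneg : IsNegligible V (gsc + gac + gnu) :=
    ((isNegligible_of_mem_singularContinuousPart hsc).add
      (isNegligible_of_mem_absolutelyContinuousPart hac)).add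
      (isNegligible_of_mem_nonUnitaryPart hnu)
  have hinner : ∀ ξ, inner ℂ (v ξ) g = inner ℂ (v ξ) gpp := fun ξ => by
    have : g = gpp + (gsc + gac + gnu) := by rw [hg]; abel
    rw [this, inner_add_right, hneg.inner_eigenvector (hVv ξ), add_zero]
  have hspan : Submodule.span ℂ {x : E | ∃ ξ : ℂ, V x = ξ • x} ≤
      Submodule.span ℂ (Set.range v) := by
    rw [Submodule.span_le]
    rintro x ⟨ξ, hx⟩
    by_cases hx0 : x = 0
    · rw [hx0]
      exact zero_mem _
    obtain ⟨c, hc⟩ := hmul x ⟨ξ, x, hx0, hx⟩ hx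
    rw [hc]
    exact Submodule.smul_mem _ _ (Submodule.subset_span (Set.mem_range_self _))
  have hsum : HasSum (fun k => inner ℂ (v' k) g • v' k) gpp := by
    have h1 := hasSum_inner_smul_of_mem_closure hv
      (Submodule.topologicalClosure_mono hspan hpp)
    rw [← e.hasSum_iff] at h1
    refine (Function.Injective.hasSum_iff (g := (Subtype.val : {k : ℕ // (k : ℕ∞) < n} → ℕ))
      Subtype.val_injective fun k hk => ?_).1 ?_
    · have : n ≤ (k : ℕ∞) := by
        by_contra h
        exact hk ⟨⟨k, not_le.1 h⟩, rfl⟩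
      rw [hv'_ge this, smul_zero]
    · convert h1 using 1
      funext k
      simp only [Function.comp_apply]
      rw [hv'_lt k.2, hinner]
  exact ⟨{
    n := n
    v := v'
    a := fun k => inner ℂ (v' k) g
    gsc := gsc
    gac := gac
    gnu := gnu
    orthonormal := by
      have : (fun i : {i : ℕ // (i : ℕ∞) < n} => v' i) = v ∘ e := by
        funext i
        exact hv'_lt i.2
      rw [this]
      exact hv.comp e e.injective
    eigenvector := fun i hi => ⟨e ⟨i, hi⟩, by rw [hv'_lt hi]; exact hVv _⟩
    complete := by
      rintro x hx0 ⟨ξ, hx⟩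
      obtain ⟨c, hc⟩ := hmul x ⟨ξ, x, hx0, hx⟩ hx
      refine ⟨e.symm ⟨ξ, x, hx0, hx⟩, (e.symm ⟨ξ, x, hx0, hx⟩).2, c, ?_⟩
      rw [hv'_lt (e.symm ⟨ξ, x, hx0, hx⟩).2, Subtype.coe_eta, Equiv.apply_symm_apply]
      exact hc
    coeff_eq_zero := fun i hi => by rw [hv'_ge hi, inner_zero_left]
    coeff_antitone := by
      intro i j hij
      show ‖inner ℂ (v' j) g‖ ≤ ‖inner ℂ (v' i) g‖
      rcases lt_or_ge (j : ℕ∞) n with hj | hj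
      · have hi : (i : ℕ∞) < n := lt_of_le_of_lt (by exact_mod_cast hij) hj
        rw [hv'_lt hj, hv'_lt hi]
        exact he ⟨i, hi⟩ ⟨j, hj⟩ hij
      · rw [hv'_ge hj, inner_zero_left, norm_zero]
        exact norm_nonneg _
    gsc_mem := hsc
    gac_mem := hac
    gnu_mem := hnu
    hasSum := by
      have : g - gsc - gac - gnu = gpp := by rw [hg]; abel
      rw [this]
      exact hsum }⟩

end Decomposition

/-- The orbit of `f` consists of the shifted series, whose span is dense in `H_f`. -/
theorem obs_cyclic {f : ℕ → ℂ} {hf : HasAutocovariances f} (w : HSpace f hf)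
    (hw : ∀ l : ℕ, inner ℂ w ((timeShift f hf ^ l) (obs f hf)) = 0) : w = 0 := by
  let mk : ∀ h : ℕ → ℂ, h ∈ shiftSpan f → PreSpace f hf := fun h hh => ⟨h, hh⟩
  have hpre : ∀ (h : ℕ → ℂ) (hh : h ∈ shiftSpan f), inner ℂ w (mk h hh : HSpace f hf) = 0 := by
    intro h hh
    induction hh using Submodule.span_induction with
    | mem x hx =>
      obtain ⟨l, rfl⟩ := hx
      have := hw l
      rw [timeShift_pow_obs] at this
      exact this
    | zero => exact inner_zero_right w
    | add y z hy hz ihy ihz =>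
      have : (mk (y + z) (add_mem hy hz) : HSpace f hf) = (mk y hy : HSpace f hf) + mk z hz :=
        UniformSpace.Completion.coe_add (mk y hy) (mk z hz)
      rw [this, inner_add_right, ihy, ihz, add_zero]
    | smul c y hy ih =>
      have : (mk (c • y) (Submodule.smul_mem _ c hy) : HSpace f hf) = c • (mk y hy : HSpace f hf) :=
        UniformSpace.Completion.coe_smul c (mk y hy)
      rw [this, inner_smul_right, ih, mul_zero]
  have hall : ∀ x : HSpace f hf, inner ℂ w x = 0 := by
    intro x
    induction x using UniformSpace.Completion.induction_on with
    | hp => exact isClosed_eq (by fun_prop) continuous_const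
    | ih x => exact hpre x.1 x.2
  exact inner_self_eq_zero.1 (hall w)

end TimeShift

end

theorem mainTheorem2 (f : ℕ → ℂ) (hf : TimeShift.HasAutocovariances f) :
    Nonempty (TimeShift.SpectralDecomposition (TimeShift.timeShift f hf) (TimeShift.obs f hf)) ∧
    ∀ D : TimeShift.SpectralDecomposition (TimeShift.timeShift f hf) (TimeShift.obs f hf),
      ∀ i : ℕ, ∃ L : ℕ → ℝ,
        (∀ N : ℕ, Tendsto (fun M : ℕ => TimeShift.gramEigenvalue f N M i / (N : ℝ))
          atTop (𝓝 (L N))) ∧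
        Tendsto L atTop (𝓝 (‖D.a i‖ ^ 2)) :=
  ⟨TimeShift.nonempty_spectralDecomposition TimeShift.obs_cyclic, fun D i =>
    -- The inner limit is the eigenvalue of the limiting Gram matrix over `N`; for `N = 0` both
    -- sides are `0` by division by zero.
    ⟨fun N => TimeShift.orbitGramEigenvalue (TimeShift.timeShift f hf) (TimeShift.obs f hf) N i / N,
      fun N => (TimeShift.tendsto_gramEigenvalue hf N i).div_const _,
      D.tendsto_orbitGramEigenvalue i⟩⟩
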